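/- Let $(\mathcal{X},d_0)$ be a compact metric space with $d_0\le 1$, let $\mathfrak{N}$ be the set of finite point measures on $\mathcal{X}$ with the $\sigma$-algebra generated by the point counts on Borel sets, and write $|\xi|=\xi(\mathcal{X})$. For $\xi=\sum_{i=1}^m\delta_{x_i}$ and $\eta=\sum_{j=1}^n\delta_{y_j}$ in $\mathfrak{N}$ with $n\ge\max(m,1)$ put $$\bar d_1(\xi,\eta)=\bar d_1(\eta,\xi)=\frac1n\Bigl(\min_{\pi}\sum_{i=1}^m d_0(x_i,y_{\pi(i)})+(n-m)\Bigr),$$ the minimum being over all permutations $\pi$ of $\{1,\dots,n\}$, and put $\bar d_1(0,0)=0$. Let $\boldsymbol\lambda$ be a finite Borel measure on $\mathcal{X}$, $\lambda=\boldsymbol\lambda(\mathcal{X})$, let $\mathrm{Po}(\boldsymbol\lambda)$ be the law of the Poisson process with expectation measure $\boldsymbol\lambda$, and for each $\xi\in\mathfrak{N}$ let $\mathbb{Z}_\xi$ be an immigration-death process with $\mathbb{Z}_\xi(0)=\xi$ and generator $$\mathcal{A}h(\xi)=\int_{\mathcal{X}}[h(\xi+\delta_\alpha)-h(\xi)]\,\boldsymbol\lambda(d\alpha)+\int_{\mathcal{X}}[h(\xi-\delta_\alpha)-h(\xi)]\,\xi(d\alpha),$$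 that is, a jump process with finitely many jumps in bounded time that solves the martingale problem for $\mathcal{A}$ on the bounded measurable functions. Let $f:\mathfrak{N}\to\mathbb{R}$ satisfy $|f(\xi)-f(\eta)|\le\bar d_1(\xi,\eta)$ for all $\xi,\eta\in\mathfrak{N}$, and let $$h_f(\xi)=-\int_0^\infty\Bigl[\mathbb{E}f(\mathbb{Z}_\xi(t))-\int f\,d\mathrm{Po}(\boldsymbol\lambda)\Bigr]dt$$ be the solution of the Stein equation $\mathcal{A}h=f-\int f\,d\mathrm{Po}(\boldsymbol\lambda)$. Then all the integrals defining $h_f$ exist (absolutely), and for all $\xi\in\mathfrak{N}$ and $\alpha,\beta\in\mathcal{X}$ $$|h_f(\xi+\delta_\alpha)-h_f(\xi)|\le\min\left\{1,\ \frac{0.95+\ln^+\lambda}{\lambda},\ \frac{1-e^{-(|\xi|\wedge\lambda)}}{|\xi|\wedge\lambda}\right\},$$ $$|h_f(\xi+\delta_\alpha+\delta_\beta)-h_f(\xi+\delta_\alpha)-h_f(\xi+\delta_\beta)+h_f(\xi)|\le\min\left\{0.75,\ \frac{1}{|\xi|\wedge\lambda},\ \frac{1.09}{|\xi|+1}+\frac1\lambda,\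 b(\lambda)\right\},$$ where $b(\lambda)=\frac{2\ln\lambda}{\lambda}$ for $\lambda\ge1.76$ and $b(\lambda)=0.75$ for $\lambda<1.76$, $\ln^+\lambda=\max(0,\ln\lambda)$ (and $\ln^+0=0$), $\frac{1-e^{0}}{0}:=1$, and every other quotient with denominator $0$ is read as $\infty$. -/

import Mathlib

open MeasureTheory ProbabilityTheory Filter Topology
open scoped NNReal ENNReal Nat

namespace PointPattern

section Configurations

variable {X : Type*}

/-- The number `ξ(A)` of points of `ξ` in `A`. A finite point measure `∑ δ_{x_i}` on `X` is
represented by the finite multiset of its atoms: `ξ + δ_α` is `α ::ₘ ξ`, the total mass `|ξ|` is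
`Multiset.card ξ`, and the zero measure is `0`. -/
noncomputable def pointCount (A : Set X) (ξ : Multiset X) : ℕ :=
  open Classical in ξ.countP (fun x => x ∈ A)

/-- The smallest σ-algebra that makes the point counts on measurable sets measurable. -/
noncomputable instance instMeasurableSpaceMultiset [MeasurableSpace X] : MeasurableSpace (Multiset X) :=
  ⨆ (A : Set X) (_ : MeasurableSet A), MeasurableSpace.comap (pointCount A) ⊤

/-- The point measure `∑ i, δ_{x i}`. -/
def ofTuple {n : ℕ} (x : Fin n → X) : Multiset X := Finset.univ.val.map x

theorem card_ofTuple {n : ℕ} (x : Fin n → X) : Multiset.card (ofTuple x) = n := by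
  simp [ofTuple]

theorem measurable_ofTuple [MeasurableSpace X] (n : ℕ) :
    Measurable (ofTuple : (Fin n → X) → Multiset X) := by
  classical
  rw [measurable_iff_comap_le]
  simp only [instMeasurableSpaceMultiset, MeasurableSpace.comap_iSup, iSup_le_iff,
    MeasurableSpace.comap_comp]
  intro A hA
  rw [← measurable_iff_comap_le]
  have h : (pointCount A ∘ ofTuple : (Fin n → X) → ℕ)
      = fun x => ∑ i : Fin n, if x i ∈ A then 1 else 0 := by
    funext x
    simp only [Function.comp, pointCount, ofTuple, Multiset.countP_map, Finset.sum_boole]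
    rfl
  rw [h]
  refine Finset.measurable_sum _ fun i _ => ?_
  exact Measurable.ite (measurable_pi_apply i hA) measurable_const measurable_const

/-- A list of the points of `ξ`. -/
noncomputable def enum (ξ : Multiset X) : Fin (Multiset.card ξ) → X :=
  fun i => ξ.toList.get (i.cast ξ.length_toList.symm)

theorem ofTuple_enum (ξ : Multiset X) : ofTuple (enum ξ) = ξ := by
  have h : List.ofFn (enum ξ) = ξ.toList := by
    apply List.ext_get
    · simp
    · intro i h1 h2
      simp [enum]
  rw [ofTuple, Fin.univ_val_map, h, Multiset.coe_toList]

theorem exists_perm_of_ofTuple_eq {n : ℕ} {x y : Fin n → X} (h : ofTuple x = ofTuple y) :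
    ∃ σ : Equiv.Perm (Fin n), x = y ∘ σ := by
  classical
  have hc : ∀ a, Fintype.card {i // x i = a} = Fintype.card {i // y i = a} := by
    intro a
    have h1 := congrArg (Multiset.countP (fun b => b = a)) h
    simp only [ofTuple, Multiset.countP_map] at h1
    rw [Fintype.card_subtype, Fintype.card_subtype]
    exact h1
  refine ⟨Equiv.ofFiberEquiv (f := x) (g := y) fun a => Fintype.equivOfCardEq (hc a), ?_⟩
  funext i
  exact (Equiv.ofFiberEquiv_map _ i).symm

end Configurations

section Metric

variable {X : Type*} [MetricSpace X]

/-- `min_π ∑_{i ≤ m} d₀(x_i, y_{π(i)})`, over the permutations `π` of `{1, …, n}`, for `m ≤ n`. -/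
noncomputable def matchCost {m n : ℕ} (h : m ≤ n) (x : Fin m → X) (y : Fin n → X) : ℝ :=
  ⨅ π : Equiv.Perm (Fin n), ∑ i : Fin m, dist (x i) (y (π (Fin.castLE h i)))

/-- The distance `d̄₁` between finite point measures: for `|ξ| = m ≤ n = |η|` it is
`(min_π ∑_{i ≤ m} d₀(x_i, y_{π(i)}) + (n - m)) / n`, symmetrically otherwise, and `d̄₁(0, 0) = 0`
(a division by zero). -/
noncomputable def dbar1 (ξ η : Multiset X) : ℝ :=
  if h : Multiset.card ξ ≤ Multiset.card η then
    (matchCost h (enum ξ) (enum η) + ((Multiset.card η : ℝ) - Multiset.card ξ))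
      / Multiset.card η
  else
    (matchCost (le_of_not_ge h) (enum η) (enum ξ)
      + ((Multiset.card ξ : ℝ) - Multiset.card η)) / Multiset.card ξ

theorem matchCost_comp_perm {m n : ℕ} (h : m ≤ n) (x : Fin m → X) (y : Fin n → X)
    (σ : Equiv.Perm (Fin m)) (τ : Equiv.Perm (Fin n)) :
    matchCost h (x ∘ σ) (y ∘ τ) = matchCost h x y := by
  let ρ : Equiv.Perm (Fin n) := σ.viaFintypeEmbedding (Fin.castLEEmb h)
  have hρ : ∀ i, ρ (Fin.castLE h i) = Fin.castLE h (σ i) := fun i =>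
    Equiv.Perm.viaFintypeEmbedding_apply_image σ (Fin.castLEEmb h) i
  unfold matchCost
  refine Equiv.iInf_congr ((Equiv.mulLeft τ).trans (Equiv.mulRight ρ⁻¹)) fun π => ?_
  rw [← Equiv.sum_comp σ]
  refine Finset.sum_congr rfl fun i _ => ?_
  simp [← hρ]

/-- `d̄₁` does not depend on how the points are listed. -/
theorem dbar1_ofTuple {m n : ℕ} (h : m ≤ n) (x : Fin m → X) (y : Fin n → X) :
    dbar1 (ofTuple x) (ofTuple y) = (matchCost h x y + ((n : ℝ) - m)) / n := by
  have key : ∀ (ξ η : Multiset X) (m n : ℕ) (hm : Multiset.card ξ = m) (hn : Multiset.card η = n)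
      (h : m ≤ n) (x : Fin m → X) (y : Fin n → X), ofTuple x = ξ → ofTuple y = η →
      dbar1 ξ η = (matchCost h x y + ((n : ℝ) - m)) / n := by
    rintro ξ η _ _ rfl rfl h x y hx hy
    obtain ⟨σ, rfl⟩ := exists_perm_of_ofTuple_eq (hx.trans (ofTuple_enum ξ).symm)
    obtain ⟨τ, rfl⟩ := exists_perm_of_ofTuple_eq (hy.trans (ofTuple_enum η).symm)
    rw [matchCost_comp_perm, dbar1, dif_pos h]
  exact key _ _ m n (card_ofTuple x) (card_ofTuple y) h x y rfl rfl

/-- `f` is Lipschitz with constant one with respect to `d̄₁`. -/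
def IsDbar1Lipschitz (f : Multiset X → ℝ) : Prop :=
  ∀ ξ η : Multiset X, |f ξ - f η| ≤ dbar1 ξ η

end Metric

section Processes

variable {X : Type*} [MeasurableSpace X]

/-- The law of the Poisson process with finite expectation measure `lam`: with `λ = lam(X)`, a
Poisson(`λ`) number of independent points with distribution `lam / λ`. The factor `λⁿ` in the
Poisson weight is absorbed into the `n`-fold product of the unnormalized measure `lam`. -/
noncomputable def poissonProcess (lam : Measure X) [IsFiniteMeasure lam] :
    Measure (Multiset X) :=
  Measure.sum fun n : ℕ =>
    ENNReal.ofReal (Real.exp (-lam.real Set.univ) / n !) •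
      (Measure.pi fun _ : Fin n => lam).map ofTuple

instance isProbabilityMeasure_poissonProcess (lam : Measure X) [IsFiniteMeasure lam] :
    IsProbabilityMeasure (poissonProcess lam) := by
  constructor
  have h : ∀ n : ℕ, (ENNReal.ofReal (Real.exp (-lam.real Set.univ) / n !) •
      (Measure.pi fun _ : Fin n => lam).map ofTuple) Set.univ
      = ENNReal.ofReal (Real.exp (-lam.real Set.univ) * (lam.real Set.univ ^ n / n !)) := by
    intro n
    rw [Measure.smul_apply, Measure.map_apply (measurable_ofTuple n) MeasurableSet.univ,
      Set.preimage_univ, Measure.pi_univ, Finset.prod_const, Finset.card_univ, Fintype.card_fin,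
      smul_eq_mul, ← ofReal_measureReal (μ := lam) (s := Set.univ),
      ← ENNReal.ofReal_pow measureReal_nonneg, ← ENNReal.ofReal_mul (by positivity)]
    congr 1
    ring
  have hs : HasSum (fun n : ℕ => Real.exp (-lam.real Set.univ) * (lam.real Set.univ ^ n / n !))
      1 := by
    have := (NormedSpace.expSeries_div_hasSum_exp (lam.real Set.univ)).mul_left
      (Real.exp (-lam.real Set.univ))
    rwa [← Real.exp_eq_exp_ℝ, ← Real.exp_add, neg_add_cancel, Real.exp_zero] at this
  rw [poissonProcess, Measure.sum_apply _ MeasurableSet.univ]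
  simp_rw [h]
  rw [← ENNReal.ofReal_tsum_of_nonneg (fun n => by positivity) hs.summable, hs.tsum_eq,
    ENNReal.ofReal_one]

/-- The generator of the spatial immigration-death process with immigration measure `lam` and unit
per capita death rate,
`𝒜 h(ξ) = ∫ (h(ξ + δ_α) - h(ξ)) lam(dα) + ∫ (h(ξ - δ_α) - h(ξ)) ξ(dα)`. -/
noncomputable def generator (lam : Measure X) (h : Multiset X → ℝ) (ξ : Multiset X) : ℝ :=
  open Classical in
  (∫ α, (h (α ::ₘ ξ) - h ξ) ∂lam) + (ξ.map fun α => h (ξ.erase α) - h ξ).sum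

/-- `Z` is, under `P`, an immigration-death process with generator `𝒜 = generator lam` and
`Z(0) = ξ`: a jump process (right-continuous paths with left limits in the discrete topology, hence
finitely many jumps in bounded time) that solves the martingale problem for `𝒜` on the bounded
measurable functions. -/
structure IsImmigrationDeathProcess (lam : Measure X) (ξ : Multiset X)
    {Ω : Type*} [mΩ : MeasurableSpace Ω] (P : Measure Ω) (Z : ℝ≥0 → Ω → Multiset X) : Prop where
  isProbabilityMeasure : IsProbabilityMeasure P
  initial : ∀ᵐ ω ∂P, Z 0 ω = ξ
  right_continuous : ∀ ω t, ∀ᶠ s in 𝓝[≥] t, Z s ω = Z t ω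
  left_limits : ∀ ω t, ∃ η, ∀ᶠ s in 𝓝[<] t, Z s ω = η
  martingale : ∃ ℱ : Filtration ℝ≥0 mΩ, (∀ t, Measurable[ℱ t] (Z t)) ∧
    ∀ h : Multiset X → ℝ, Measurable h → (∃ C, ∀ η, |h η| ≤ C) →
      Martingale (fun (t : ℝ≥0) ω =>
        h (Z t ω) - h (Z 0 ω) - ∫ s in (0 : ℝ)..t, generator lam h (Z s.toNNReal ω)) ℱ P

/-- `𝔼 f(Z_ξ(t)) - Po(lam)(f)`, where `Z ξ` is considered under `P ξ`. -/
noncomputable def expectationGap (lam : Measure X) [IsFiniteMeasure lam] {Ω : Type*}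
    [MeasurableSpace Ω] (P : Multiset X → Measure Ω) (Z : Multiset X → ℝ≥0 → Ω → Multiset X)
    (f : Multiset X → ℝ) (ξ : Multiset X) (t : ℝ≥0) : ℝ :=
  (∫ ω, f (Z ξ t ω) ∂(P ξ)) - ∫ η, f η ∂(poissonProcess lam)

/-- The solution `h_f(ξ) = -∫_0^∞ (𝔼 f(Z_ξ(t)) - Po(lam)(f)) dt` of the Stein equation
`𝒜 h = f - Po(lam)(f)`. -/
noncomputable def steinSolution (lam : Measure X) [IsFiniteMeasure lam] {Ω : Type*}
    [MeasurableSpace Ω] (P : Multiset X → Measure Ω) (Z : Multiset X → ℝ≥0 → Ω → Multiset X)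
    (f : Multiset X → ℝ) (ξ : Multiset X) : ℝ :=
  -∫ t in Set.Ioi (0 : ℝ), expectationGap lam P Z f ξ t.toNNReal

end Processes

section Differences

variable {X : Type*}

/-- `Δh(ξ; α) = h(ξ + δ_α) - h(ξ)`. -/
def firstDiff (h : Multiset X → ℝ) (ξ : Multiset X) (α : X) : ℝ :=
  h (α ::ₘ ξ) - h ξ

/-- `Δ²h(ξ; α, β) = h(ξ + δ_α + δ_β) - h(ξ + δ_α) - h(ξ + δ_β) + h(ξ)`. -/
def secondDiff (h : Multiset X → ℝ) (ξ : Multiset X) (α β : X) : ℝ :=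
  h (β ::ₘ α ::ₘ ξ) - h (α ::ₘ ξ) - h (β ::ₘ ξ) + h ξ

/-- `(1 - e^{-u}) / u`, with value `1` at `u = 0`. -/
noncomputable def expQuotient (u : ℝ) : ℝ :=
  if u = 0 then 1 else (1 - Real.exp (-u)) / u

end Differences

end PointPattern

open PointPattern

/-! The process at time `t` is the union of the initial points, each surviving independently with
probability `p = e^{-t}`, and an independent Poisson process with expectation measure `(1 - p) lam`.
From the martingale problem this is obtained in the form of the generating functional `𝔼 ∏ u(x)`
(`IsImmigrationDeathProcess.integral_prodFunctional`): the candidate formula solves the backward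
equation, so its value along the process, with the remaining time as parameter, has constant
expectation. Generating functionals determine laws (`ext_of_forall_integral_prodFunctional`). Hence
an extra initial point `α` turns the law at time `t` into a mixture: with weight `e^{-t}` the old
configuration plus `δ_α`, otherwise the old configuration (`IsImmigrationDeathProcess.map_cons`). No
coupling is built; only one-dimensional marginals are compared.

Consequently `Δh_f(ξ; α) = -∫ e^{-t} 𝔼 Δf(Z_ξ(t); α) dt`, and the second difference carries the
factor `e^{-2t}` (`firstDiff_steinSolution`, `secondDiff_steinSolution`). The Lipschitz property
gives `|Δf(η)| ≤ 1/(|η|+1)` and `|Δ²f(η)| ≤ 1/(|η|+1) + 1/(|η|+2)`, which are the integrals over `v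
∈ [0,1]` of `(1-v)^{|η|}` and `(2-v)(1-v)^{|η|}`. Taking expectations replaces the power by the
generating function `countPGF` of the number of points, and the substitution `p = e^{-t}` leaves a
double integral over the unit square, with an additional weight `p` for second differences.

Each stated bound comes from one elementary majorant of `countPGF`: `1`, `exp(-v min(n, l))`,
`exp(-v l (1-p))`, or `exp(-v (n p + l (1-p)))`. The logarithms arise from integrating `1/a` over `a
= l(1-p)` between `1` and `l`.

The integral defining `h_f` converges absolutely because the expectation gap decays like `e^{-t}`
(`abs_expectationGap_le`): from the empty configuration two Poisson laws are compared, and every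
further initial point costs at most `2 e^{-t}`. -/

namespace PointPattern

/-! ### Measurability of functionals of point configurations -/

section Measurability

variable {X : Type*} [MeasurableSpace X]

theorem measurable_pointCount {A : Set X} (hA : MeasurableSet A) :
    Measurable (pointCount A) := by
  rw [measurable_iff_comap_le]
  exact le_iSup₂_of_le A hA le_rfl

omit [MeasurableSpace X] in
theorem pointCount_univ (ξ : Multiset X) : pointCount Set.univ ξ = Multiset.card ξ := by
  simp [pointCount]

theorem measurable_card : Measurable (Multiset.card : Multiset X → ℕ) := by
  have h : (Multiset.card : Multiset X → ℕ) = pointCount Set.univ :=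
    funext fun ξ => (pointCount_univ ξ).symm
  rw [h]
  exact measurable_pointCount MeasurableSet.univ

omit [MeasurableSpace X] in
theorem pointCount_cons (A : Set X) (α : X) (ξ : Multiset X) [Decidable (α ∈ A)] :
    pointCount A (α ::ₘ ξ) = pointCount A ξ + if α ∈ A then 1 else 0 := by
  classical
  simp only [pointCount, Multiset.countP_cons]
  congr

theorem measurable_cons (α : X) : Measurable (fun ξ : Multiset X => α ::ₘ ξ) := by
  classical
  rw [measurable_iff_comap_le]
  conv_lhs => rw [instMeasurableSpaceMultiset]
  simp only [MeasurableSpace.comap_iSup, iSup_le_iff, MeasurableSpace.comap_comp]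
  intro A hA
  rw [← measurable_iff_comap_le]
  have h : (pointCount A ∘ fun ξ : Multiset X => α ::ₘ ξ)
      = fun ξ => pointCount A ξ + if α ∈ A then 1 else 0 :=
    funext fun ξ => pointCount_cons A α ξ
  rw [h]
  exact (measurable_pointCount hA).add_const _

/-- After discretizing the space by a simple function, a configuration is determined by finitely
many point counts. -/
theorem map_simpleFunc_eq_sum {Y : Type*} (r : SimpleFunc X Y) (ξ : Multiset X) :
    ξ.map r = ∑ y : r.range, pointCount (r ⁻¹' {(y : Y)}) ξ • ({(y : Y)} : Multiset Y) := by
  classical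
  induction ξ using Multiset.induction_on with
  | empty => simp [pointCount]
  | cons a ξ ih =>
    simp only [pointCount_cons, add_smul, Finset.sum_add_distrib, ← ih, Multiset.map_cons]
    rw [Finset.sum_eq_single (⟨r a, r.mem_range_self a⟩ : r.range)]
    · simp [add_comm (Multiset.map r ξ)]
    · intro y _ hy
      have : ¬ r a = (y : Y) := fun h => hy (Subtype.ext h.symm)
      simp [this]
    · simp

/-- The map factors through the countable discrete space of count vectors, so `F` may be arbitrary.
Measurability of a general functional then follows by approximating the identity or the test
function by simple functions. -/
theorem measurable_comp_map_simpleFunc {Y E : Type*} [MeasurableSpace E] (r : SimpleFunc X Y)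
    (F : Multiset Y → E) : Measurable fun ξ : Multiset X => F (ξ.map r) := by
  have h : (fun ξ : Multiset X => F (ξ.map r))
      = (fun c : r.range → ℕ => F (∑ y : r.range, c y • ({(y : Y)} : Multiset Y))) ∘
        fun ξ y => pointCount (r ⁻¹' {(y : Y)}) ξ := by
    funext ξ
    simp only [Function.comp, map_simpleFunc_eq_sum]
  rw [h]
  exact (measurable_of_countable _).comp
    (measurable_pi_lambda _ fun y => measurable_pointCount (r.measurableSet_fiber _))

/-- The multiplicative functional `ξ ↦ ∏_{x ∈ ξ} u(x)`. -/
noncomputable def prodFunctional (u : X → ℝ) (ξ : Multiset X) : ℝ := (ξ.map u).prod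

omit [MeasurableSpace X] in
@[simp] theorem prodFunctional_zero (u : X → ℝ) : prodFunctional u 0 = 1 := by
  simp [prodFunctional]

omit [MeasurableSpace X] in
@[simp] theorem prodFunctional_cons (u : X → ℝ) (α : X) (ξ : Multiset X) :
    prodFunctional u (α ::ₘ ξ) = u α * prodFunctional u ξ := by
  simp [prodFunctional]

omit [MeasurableSpace X] in
theorem prodFunctional_nonneg {u : X → ℝ} (h0 : ∀ x, 0 ≤ u x) (ξ : Multiset X) :
    0 ≤ prodFunctional u ξ := by
  induction ξ using Multiset.induction_on with
  | empty => simp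
  | cons a ξ ih => rw [prodFunctional_cons]; exact mul_nonneg (h0 a) ih

omit [MeasurableSpace X] in
theorem prodFunctional_le_one {u : X → ℝ} (h0 : ∀ x, 0 ≤ u x) (h1 : ∀ x, u x ≤ 1)
    (ξ : Multiset X) : prodFunctional u ξ ≤ 1 := by
  induction ξ using Multiset.induction_on with
  | empty => simp
  | cons a ξ ih =>
    rw [prodFunctional_cons]
    exact mul_le_one₀ (h1 a) (prodFunctional_nonneg h0 ξ) ih

omit [MeasurableSpace X] in
theorem abs_prodFunctional_le_one {u : X → ℝ} (h0 : ∀ x, 0 ≤ u x) (h1 : ∀ x, u x ≤ 1)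
    (ξ : Multiset X) : |prodFunctional u ξ| ≤ 1 := by
  rw [abs_of_nonneg (prodFunctional_nonneg h0 ξ)]
  exact prodFunctional_le_one h0 h1 ξ

omit [MeasurableSpace X] in
theorem prodFunctional_const (s : ℝ) (ξ : Multiset X) :
    prodFunctional (fun _ => s) ξ = s ^ Multiset.card ξ := by
  simp [prodFunctional]

omit [MeasurableSpace X] in
theorem prodFunctional_ofTuple (u : X → ℝ) {n : ℕ} (x : Fin n → X) :
    prodFunctional u (ofTuple x) = ∏ i, u (x i) := by
  simp only [prodFunctional, ofTuple, Multiset.map_map]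
  rfl

theorem measurable_prodFunctional {u : X → ℝ} (hu : Measurable u) :
    Measurable (prodFunctional u) := by
  refine measurable_of_tendsto_metrizable
    (f := fun n ξ => prodFunctional (hu.stronglyMeasurable.approx n) ξ)
    (fun n => measurable_comp_map_simpleFunc (hu.stronglyMeasurable.approx n) Multiset.prod)
    (tendsto_pi_nhds.2 fun ξ => ?_)
  induction ξ using Multiset.induction_on with
  | empty => simp
  | cons a ξ ih =>
    simp only [prodFunctional_cons]
    exact (hu.stronglyMeasurable.tendsto_approx a).mul ih

end Measurability

/-! ### Generating functionals determine laws -/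

section Uniqueness

variable {X : Type*} [MeasurableSpace X]

/-- Finite measures on `ℕ^ι` with the same probability generating function agree. -/
theorem ext_of_forall_integral_prod_pow {ι : Type*} [Fintype ι] {μ ν : Measure (ι → ℕ)}
    [IsFiniteMeasure μ] [IsFiniteMeasure ν]
    (h : ∀ z : ι → ℝ, (∀ i, 0 ≤ z i) → (∀ i, z i ≤ 1) →
      ∫ c, ∏ i, z i ^ c i ∂μ = ∫ c, ∏ i, z i ^ c i ∂ν) : μ = ν := by
  classical
  let g : {z : ι → ℝ // (∀ i, 0 ≤ z i) ∧ ∀ i, z i ≤ 1} → BoundedContinuousFunction (ι → ℕ) ℝ :=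
    fun z => BoundedContinuousFunction.ofNormedAddCommGroup (fun c => ∏ i, z.1 i ^ c i)
      (continuous_finsetProd _ fun i _ =>
        (continuous_of_discreteTopology (f := fun n : ℕ => z.1 i ^ n)).comp (continuous_apply i)) 1
      (fun c => by
        rw [Real.norm_eq_abs, abs_of_nonneg
          (Finset.prod_nonneg fun i _ => pow_nonneg (z.2.1 i) _)]
        exact Finset.prod_le_one (fun i _ => pow_nonneg (z.2.1 i) _)
          fun i _ => pow_le_one₀ (z.2.1 i) (z.2.2 i))
  have hg : ∀ z c, g z c = ∏ i, z.1 i ^ c i := fun z c => rfl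
  -- The monomials are closed under multiplication, so the algebra they generate is their linear
  -- span, and agreement of the integrals extends to it by linearity.
  let M : Submonoid (BoundedContinuousFunction (ι → ℕ) ℝ) :=
    { carrier := Set.range g
      one_mem' := ⟨⟨fun _ => 1, by simp, by simp⟩, by ext c; simp [hg]⟩
      mul_mem' := by
        rintro _ _ ⟨z, rfl⟩ ⟨w, rfl⟩
        refine ⟨⟨fun i => z.1 i * w.1 i, fun i => mul_nonneg (z.2.1 i) (w.2.1 i),
          fun i => mul_le_one₀ (z.2.2 i) (w.2.1 i) (w.2.2 i)⟩, ?_⟩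
        ext c
        simp [hg, mul_pow, Finset.prod_mul_distrib] }
  let B : Subalgebra ℝ (BoundedContinuousFunction (ι → ℕ) ℝ) := Algebra.adjoin ℝ (M : Set _)
  let A : StarSubalgebra ℝ (BoundedContinuousFunction (ι → ℕ) ℝ) :=
    { B with
      star_mem' := by
        intro a ha
        have : star a = a := by ext c; simp
        rw [this]; exact ha }
  refine ext_of_forall_mem_subalgebra_integral_eq_of_pseudoEMetric_complete_countable
    (𝕜 := ℝ) (A := A) ?_ ?_
  · intro c d hcd
    obtain ⟨i, hi⟩ : ∃ i, c i ≠ d i := by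
      by_contra hcon
      push Not at hcon
      exact hcd (funext hcon)
    -- Points are separated by `(1/2)^{c i}`, for a coordinate `i` in which they differ.
    let z : {z : ι → ℝ // (∀ i, 0 ≤ z i) ∧ ∀ i, z i ≤ 1} :=
      ⟨fun j => if j = i then 1 / 2 else 1, fun j => by dsimp only; split_ifs <;> norm_num,
        fun j => by dsimp only; split_ifs <;> norm_num⟩
    have hz : ∀ e : ι → ℕ, g z e = (1 / 2 : ℝ) ^ e i := by
      intro e
      rw [hg, Finset.prod_eq_single i]
      · simp [z]
      · intro j _ hj
        simp [z, hj]
      · simp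
    refine ⟨_, ⟨_, ⟨g z, Algebra.subset_adjoin ⟨z, rfl⟩, rfl⟩, rfl⟩, ?_⟩
    change g z c ≠ g z d
    rw [hz, hz]
    exact fun hh => hi (pow_right_injective₀ (by norm_num) (by norm_num) hh)
  · intro a ha
    have ha' : a ∈ Submodule.span ℝ (M : Set (BoundedContinuousFunction (ι → ℕ) ℝ)) := by
      have : a ∈ Subalgebra.toSubmodule B := ha
      rwa [Algebra.adjoin_eq_span, Submonoid.closure_eq] at this
    induction ha' using Submodule.span_induction with
    | mem x hx =>
      obtain ⟨z, rfl⟩ := hx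
      exact h z.1 z.2.1 z.2.2
    | zero => simp
    | add x y hx' hy' hx hy =>
      have hmem : ∀ w ∈ Submodule.span ℝ (M : Set (BoundedContinuousFunction (ι → ℕ) ℝ)),
          w ∈ A := fun w hw => Algebra.span_le_adjoin ℝ _ hw
      simp only [BoundedContinuousFunction.coe_add, Pi.add_apply]
      rw [integral_add (x.integrable μ) (y.integrable μ),
        integral_add (x.integrable ν) (y.integrable ν), hx (hmem x hx'), hy (hmem y hy')]
    | smul r x hx' hx =>
      have hmem : x ∈ A := Algebra.span_le_adjoin ℝ _ hx'
      simp only [BoundedContinuousFunction.coe_smul, integral_smul, hx hmem]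

/-- Finite measures on point configurations with the same probability generating functional
agree. -/
theorem ext_of_forall_integral_prodFunctional {μ ν : Measure (Multiset X)}
    [IsFiniteMeasure μ] [IsFiniteMeasure ν]
    (h : ∀ u : X → ℝ, Measurable u → (∀ x, 0 ≤ u x) → (∀ x, u x ≤ 1) →
      ∫ ξ, prodFunctional u ξ ∂μ = ∫ ξ, prodFunctional u ξ ∂ν) : μ = ν := by
  classical
  let m : {A : Set X // MeasurableSet A} → MeasurableSpace (Multiset X) :=
    fun A => MeasurableSpace.comap (pointCount A.1) ⊤
  -- Finite intersections of events about single counts form a generating π-system, so it suffices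
  -- to identify the joint laws of finitely many counts.
  have hgen : (instMeasurableSpaceMultiset : MeasurableSpace (Multiset X))
      = MeasurableSpace.generateFrom
          (piiUnionInter (fun A => {s | MeasurableSet[m A] s}) Set.univ) := by
    refine Eq.trans ?_ (generateFrom_piiUnionInter_measurableSet m Set.univ).symm
    simp only [instMeasurableSpaceMultiset, Set.mem_univ, iSup_pos]
    rw [iSup_subtype']
  refine ext_of_generate_finite _ hgen
    (isPiSystem_piiUnionInter _ (fun A => @MeasurableSpace.isPiSystem_measurableSet _ (m A)) _)
    ?_ ?_
  · rintro s ⟨t, -, f, hf, rfl⟩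
    choose! B hB using hf
    let c : Multiset X → (t → ℕ) := fun ξ A => pointCount A.1.1 ξ
    have hc : Measurable c := measurable_pi_lambda _ fun A => measurable_pointCount A.1.2
    have hμν : μ.map c = ν.map c := by
      refine ext_of_forall_integral_prod_pow fun z hz0 hz1 => ?_
      have hm : Measurable fun c : t → ℕ => ∏ i, z i ^ c i := measurable_of_countable _
      rw [integral_map hc.aemeasurable hm.aestronglyMeasurable,
        integral_map hc.aemeasurable hm.aestronglyMeasurable]
      -- With this `u`, the product over the points of `ξ` is the monomial `∏ z_A ^ ξ(A)`. The sets
      -- `A` may overlap, because a point contributes one factor for each set containing it.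
      let u : X → ℝ := fun x => ∏ A : t, if x ∈ A.1.1 then z A else 1
      have hu : ∀ ξ, ∏ i, z i ^ c ξ i = prodFunctional u ξ := by
        intro ξ
        induction ξ using Multiset.induction_on with
        | empty => simp [c, pointCount]
        | cons a ξ ih =>
          rw [prodFunctional_cons, ← ih, ← Finset.prod_mul_distrib]
          refine Finset.prod_congr rfl fun A _ => ?_
          simp only [c, pointCount_cons]
          split_ifs <;> simp [pow_succ, mul_comm]
      simp_rw [hu]
      refine h u ?_ ?_ ?_
      · exact Finset.measurable_prod _ fun A _ =>
          Measurable.ite A.1.2 measurable_const measurable_const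
      · exact fun x => Finset.prod_nonneg fun A _ => by split_ifs; exacts [hz0 A, zero_le_one]
      · exact fun x => Finset.prod_le_one
          (fun A _ => by split_ifs; exacts [hz0 A, zero_le_one])
          (fun A _ => by split_ifs; exacts [hz1 A, le_rfl])
    have hs : (⋂ x ∈ t, f x) = c ⁻¹' {v | ∀ A : t, v A ∈ B A.1} := by
      ext ξ
      simp only [Set.mem_iInter, Set.mem_preimage, Set.mem_ofPred_eq]
      refine ⟨fun hh A => ?_, fun hh A hA => ?_⟩
      · have := hh A.1 A.2
        rw [← (hB A.1 A.2).2] at this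
        exact this
      · rw [← (hB A hA).2]
        exact hh ⟨A, hA⟩
    rw [hs, ← Measure.map_apply hc (Set.to_countable _).measurableSet, hμν,
      Measure.map_apply hc (Set.to_countable _).measurableSet]
  · have := h (fun _ => 1) measurable_const (fun _ => zero_le_one) fun _ => le_rfl
    simp only [prodFunctional_const, one_pow, integral_const, smul_eq_mul, mul_one] at this
    exact (ENNReal.toReal_eq_toReal_iff' (measure_ne_top _ _) (measure_ne_top _ _)).1 this

end Uniqueness

/-! ### Consequences of the Lipschitz property -/

section Lipschitz

variable {X : Type*} [MetricSpace X]

theorem matchCost_le {m n : ℕ} (h : m ≤ n) (x : Fin m → X) (y : Fin n → X) :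
    matchCost h x y ≤ ∑ i : Fin m, dist (x i) (y (Fin.castLE h i)) :=
  ciInf_le (Set.finite_range _).bddBelow (Equiv.refl _)

theorem dbar1_le_one (hd : ∀ x y : X, dist x y ≤ 1) {ξ η : Multiset X}
    (h : Multiset.card ξ ≤ Multiset.card η) : dbar1 ξ η ≤ 1 := by
  rw [dbar1, dif_pos h]
  refine div_le_one_of_le₀ ?_ (Nat.cast_nonneg _)
  have h1 := (matchCost_le h (enum ξ) (enum η)).trans
    (Finset.sum_le_sum (g := fun _ => (1 : ℝ)) fun i _ => hd _ _)
  simp only [Finset.sum_const, Finset.card_univ, Fintype.card_fin, nsmul_eq_mul, mul_one] at h1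
  linarith

/-- Matching every point of `ξ` with itself costs nothing; the single unmatched point costs `1`,
normalized by the larger cardinality `|ξ| + 1`. -/
theorem dbar1_cons_le (ξ : Multiset X) (α : X) :
    dbar1 ξ (α ::ₘ ξ) ≤ 1 / ((Multiset.card ξ : ℝ) + 1) := by
  have hy : ofTuple (Fin.snoc (α := fun _ => X) (enum ξ) α) = α ::ₘ ξ := by
    conv_rhs => rw [← ofTuple_enum ξ]
    simp only [ofTuple, Fin.univ_castSuccEmb, Finset.cons_val, Multiset.map_cons, Fin.snoc_last,
      Finset.map_val, Multiset.map_map]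
    simp [Function.comp_def]
  have h := dbar1_ofTuple (Nat.le_succ _) (enum ξ) (Fin.snoc (α := fun _ => X) (enum ξ) α)
  rw [hy, ofTuple_enum] at h
  rw [h]
  have h1 := matchCost_le (Nat.le_succ _) (enum ξ) (Fin.snoc (α := fun _ => X) (enum ξ) α)
  have h2 : ∀ i : Fin (Multiset.card ξ), (Fin.snoc (α := fun _ => X) (enum ξ) α)
      (Fin.castLE (Nat.le_succ _) i) = enum ξ i := fun i =>
    Fin.snoc_castSucc (α := fun _ => X) _ _ i
  simp only [h2, dist_self, Finset.sum_const_zero] at h1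
  push_cast
  gcongr
  linarith

variable {f : Multiset X → ℝ}

theorem IsDbar1Lipschitz.abs_firstDiff_le (hf : IsDbar1Lipschitz f) (ξ : Multiset X) (α : X) :
    |firstDiff f ξ α| ≤ 1 / ((Multiset.card ξ : ℝ) + 1) := by
  rw [firstDiff, abs_sub_comm]
  exact (hf _ _).trans (dbar1_cons_le ξ α)

theorem IsDbar1Lipschitz.abs_secondDiff_le (hf : IsDbar1Lipschitz f) (ξ : Multiset X) (α β : X) :
    |secondDiff f ξ α β|
      ≤ 1 / ((Multiset.card ξ : ℝ) + 1) + 1 / ((Multiset.card ξ : ℝ) + 2) := by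
  have h1 := hf.abs_firstDiff_le (α ::ₘ ξ) β
  have h2 := hf.abs_firstDiff_le ξ β
  have h3 : secondDiff f ξ α β = firstDiff f (α ::ₘ ξ) β - firstDiff f ξ β := by
    simp only [secondDiff, firstDiff]; ring
  rw [h3]
  refine (abs_sub _ _).trans ?_
  rw [Multiset.card_cons] at h1
  push_cast at h1
  rw [add_assoc] at h1
  norm_num at h1 h2 ⊢
  linarith

theorem IsDbar1Lipschitz.abs_sub_zero_le (hd : ∀ x y : X, dist x y ≤ 1)
    (hf : IsDbar1Lipschitz f) (ξ : Multiset X) : |f ξ - f 0| ≤ 1 := by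
  rw [abs_sub_comm]
  exact (hf _ _).trans (dbar1_le_one hd (by simp))

/-- Every point is moved to the nearest of the first members of a dense sequence. Matching points
with their images shows that the moved configurations converge in `d̄₁`, and on them `f` depends
only on finitely many counts. -/
theorem IsDbar1Lipschitz.measurable [MeasurableSpace X] [BorelSpace X]
    [SecondCountableTopology X] (hf : IsDbar1Lipschitz f) : Measurable f := by
  rcases isEmpty_or_nonempty X with hX | hX
  · have : f = fun _ => f 0 := funext fun ξ => by rw [Subsingleton.elim ξ 0]
    rw [this]; exact measurable_const
  let r : ℕ → SimpleFunc X X := fun N => SimpleFunc.nearestPt (TopologicalSpace.denseSeq X) N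
  refine measurable_of_tendsto_metrizable (f := fun N ξ => f (ξ.map (r N)))
    (fun N => measurable_comp_map_simpleFunc (r N) f) (tendsto_pi_nhds.2 fun ξ => ?_)
  have hb : ∀ N, dist (f (ξ.map (r N))) (f ξ)
      ≤ (∑ i, dist (enum ξ i) (r N (enum ξ i))) / Multiset.card ξ := by
    intro N
    rw [dist_comm, Real.dist_eq]
    refine (hf _ _).trans ?_
    have h1 : ofTuple (fun i => r N (enum ξ i)) = ξ.map (r N) := by
      conv_rhs => rw [← ofTuple_enum ξ]
      simp [ofTuple, Function.comp_def]
    have h2 := dbar1_ofTuple le_rfl (enum ξ) (fun i => r N (enum ξ i))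
    rw [h1, ofTuple_enum, sub_self, add_zero] at h2
    rw [h2]
    gcongr
    exact matchCost_le _ _ _
  rw [tendsto_iff_dist_tendsto_zero]
  refine squeeze_zero (fun _ => dist_nonneg) hb ?_
  have h0 : Tendsto (fun N => ∑ i, dist (enum ξ i) (r N (enum ξ i))) atTop (𝓝 0) := by
    rw [show (0 : ℝ) = ∑ i : Fin (Multiset.card ξ), dist (enum ξ i) (enum ξ i) by simp]
    refine tendsto_finsetSum _ fun i _ => tendsto_const_nhds.dist ?_
    exact SimpleFunc.tendsto_nearestPt (by 
      rw [(TopologicalSpace.denseRange_denseSeq X).closure_range]; trivial)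
  simpa using h0.div_const (Multiset.card ξ : ℝ)

end Lipschitz

end PointPattern

namespace PointPattern

/-! ### Thinned product functionals and the generator -/

section Thinning

variable {X : Type*}

/-- The retention-`p` thinning of a test function, `x ↦ 1 - p (1 - u(x))`. -/
def thinFunction (p : ℝ) (u : X → ℝ) (x : X) : ℝ := 1 - p * (1 - u x)

theorem thinFunction_nonneg {p : ℝ} {u : X → ℝ} (hp0 : 0 ≤ p) (hp1 : p ≤ 1)
    (h0 : ∀ x, 0 ≤ u x) (x : X) : 0 ≤ thinFunction p u x := by
  rw [thinFunction]; nlinarith [h0 x, mul_nonneg hp0 (h0 x)]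

theorem thinFunction_le_one {p : ℝ} {u : X → ℝ} (hp0 : 0 ≤ p)
    (h1 : ∀ x, u x ≤ 1) (x : X) : thinFunction p u x ≤ 1 := by
  rw [thinFunction]; nlinarith [mul_nonneg hp0 (sub_nonneg.2 (h1 x))]

theorem measurable_thinFunction [MeasurableSpace X] {u : X → ℝ} (hu : Measurable u) (p : ℝ) :
    Measurable (thinFunction p u) :=
  measurable_const.sub ((measurable_const.sub hu).const_mul p)

/-- The death part of the generator applied to `prodFunctional u`. -/
noncomputable def removalSum (u : X → ℝ) (ξ : Multiset X) : ℝ :=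
  open Classical in
  (ξ.map fun α => prodFunctional u (ξ.erase α) - prodFunctional u ξ).sum

@[simp] theorem removalSum_zero (u : X → ℝ) : removalSum u 0 = 0 := by
  simp [removalSum]

theorem removalSum_cons (u : X → ℝ) (a : X) (ξ : Multiset X) :
    removalSum u (a ::ₘ ξ) = (1 - u a) * prodFunctional u ξ + u a * removalSum u ξ := by
  classical
  have h : ∀ x ∈ ξ, prodFunctional u ((a ::ₘ ξ).erase x) - prodFunctional u (a ::ₘ ξ)
      = u a * (prodFunctional u (ξ.erase x) - prodFunctional u ξ) := by
    intro x hx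
    have : (a ::ₘ ξ).erase x = a ::ₘ ξ.erase x := by
      by_cases hxa : a = x
      · subst hxa
        rw [Multiset.erase_cons_head, Multiset.cons_erase hx]
      · rw [Multiset.erase_cons_tail _ hxa]
    rw [this, prodFunctional_cons, prodFunctional_cons]
    ring
  have hsum : (ξ.map fun x => prodFunctional u ((a ::ₘ ξ).erase x)
      - prodFunctional u (a ::ₘ ξ)).sum = u a * removalSum u ξ := by
    rw [Multiset.map_congr rfl h, removalSum, Multiset.sum_map_mul_left]
  rw [← hsum]
  simp only [removalSum, Multiset.map_cons, Multiset.sum_cons, Multiset.erase_cons_head,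
    prodFunctional_cons]
  congr 1
  ring

/-- The recursion exhibits the sum as a convex combination, with weights `1 - u a` and `u a`, of two
numbers in `[0,1]`. So the death part stays bounded on product functionals although the total death
rate `|ξ|` is unbounded; this is what makes Dynkin's formula usable for them. -/
theorem removalSum_mem_Icc {u : X → ℝ} (h0 : ∀ x, 0 ≤ u x) (h1 : ∀ x, u x ≤ 1)
    (ξ : Multiset X) : removalSum u ξ ∈ Set.Icc (0 : ℝ) 1 := by
  induction ξ using Multiset.induction_on with
  | empty => simp
  | cons a ξ ih =>
    rw [removalSum_cons]
    have hp0 := prodFunctional_nonneg h0 ξ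
    have hp1 := prodFunctional_le_one h0 h1 ξ
    have ha0 := h0 a
    have ha1 := sub_nonneg.2 (h1 a)
    refine ⟨add_nonneg (mul_nonneg ha1 hp0) (mul_nonneg ha0 ih.1), ?_⟩
    nlinarith [mul_le_mul_of_nonneg_left hp1 ha1, mul_le_mul_of_nonneg_left ih.2 ha0]

theorem continuous_prodFunctional_thin (u : X → ℝ) (ξ : Multiset X) :
    Continuous fun p : ℝ => prodFunctional (thinFunction p u) ξ := by
  induction ξ using Multiset.induction_on with
  | empty => simp only [prodFunctional_zero]; exact continuous_const
  | cons a ξ ih =>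
    simp only [prodFunctional_cons]
    refine Continuous.mul ?_ ih
    unfold thinFunction
    fun_prop

theorem continuous_removalSum_thin (u : X → ℝ) (ξ : Multiset X) :
    Continuous fun p : ℝ => removalSum (thinFunction p u) ξ := by
  induction ξ using Multiset.induction_on with
  | empty => simp only [removalSum_zero]; exact continuous_const
  | cons a ξ ih =>
    simp only [removalSum_cons]
    have h : Continuous fun p : ℝ => thinFunction p u a := by unfold thinFunction; fun_prop
    exact ((continuous_const.sub h).mul (continuous_prodFunctional_thin u ξ)).add (h.mul ih)

/-- The derivative of the factor `1 - e^{-r}(1 - u a)` is one minus that factor, so the product rule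
is exactly the recursion of `removalSum_cons`. -/
theorem hasDerivAt_prodFunctional_thin (u : X → ℝ) (ξ : Multiset X) (r : ℝ) :
    HasDerivAt (fun r : ℝ => prodFunctional (thinFunction (Real.exp (-r)) u) ξ)
      (removalSum (thinFunction (Real.exp (-r)) u) ξ) r := by
  induction ξ using Multiset.induction_on with
  | empty => simp only [prodFunctional_zero, removalSum_zero]; exact hasDerivAt_const _ _
  | cons a ξ ih =>
    simp only [prodFunctional_cons, removalSum_cons]
    have h : HasDerivAt (fun r : ℝ => thinFunction (Real.exp (-r)) u a)
        (1 - thinFunction (Real.exp (-r)) u a) r := by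
      unfold thinFunction
      have := (((hasDerivAt_neg r).exp).mul_const (1 - u a)).const_sub 1
      exact this.congr_deriv (by ring)
    exact h.mul ih

theorem thinFunction_one (u : X → ℝ) : thinFunction 1 u = u := by
  funext x; simp [thinFunction]

/-- The sum is the derivative at `r = 0` of the thinned product functional, hence a limit of
measurable difference quotients. -/
theorem measurable_removalSum [MeasurableSpace X] {u : X → ℝ} (hu : Measurable u) :
    Measurable (removalSum u) := by
  let e : ℕ → ℝ := fun n => 1 / ((n : ℝ) + 1)
  have he : Tendsto e atTop (𝓝[≠] 0) := by
    rw [tendsto_nhdsWithin_iff]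
    exact ⟨tendsto_one_div_add_atTop_nhds_zero_nat,
      Eventually.of_forall fun n => (by positivity : (0 : ℝ) < e n).ne'⟩
  refine measurable_of_tendsto_metrizable
    (f := fun n ξ => (e n)⁻¹ * (prodFunctional (thinFunction (Real.exp (-(e n))) u) ξ
      - prodFunctional u ξ)) (fun n => ?_) (tendsto_pi_nhds.2 fun ξ => ?_)
  · exact ((measurable_prodFunctional (measurable_thinFunction hu _)).sub
      (measurable_prodFunctional hu)).const_mul _
  · have h := (hasDerivAt_prodFunctional_thin u ξ 0).tendsto_slope_zero.comp he
    simpa [Function.comp_def, thinFunction_one] using h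

theorem generator_prodFunctional [MeasurableSpace X] (lam : Measure X) (u : X → ℝ)
    (ξ : Multiset X) :
    generator lam (prodFunctional u) ξ
      = prodFunctional u ξ * ∫ x, (u x - 1) ∂lam + removalSum u ξ := by
  rw [generator, removalSum, ← integral_const_mul]
  congr 1
  refine integral_congr_ae (Eventually.of_forall fun x => ?_)
  simp only [prodFunctional_cons]
  ring

end Thinning

/-! ### Dynkin's formula for right-continuous jump paths -/

section Dynkin

variable {X : Type*} [MeasurableSpace X] {Ω : Type*} [MeasurableSpace Ω]

theorem measurable_uncurry_of_right_continuous {Z : ℝ≥0 → Ω → Multiset X}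
    (hZm : ∀ t, Measurable (Z t)) (hZr : ∀ ω t, ∀ᶠ s in 𝓝[≥] t, Z s ω = Z t ω)
    {k : Multiset X → ℝ} (hk : Measurable k) :
    Measurable fun p : ℝ≥0 × Ω => k (Z p.1 p.2) := by
  -- The next grid point to the right of `t` on the grid of mesh `1/(n+1)`. It takes countably many
  -- values and tends to `t` from the right, where the path is eventually constant.
  let d : ℕ → ℝ≥0 → ℝ≥0 := fun n t => ((⌊((n : ℝ≥0) + 1) * t⌋₊ : ℝ≥0) + 1) / ((n : ℝ≥0) + 1)
  refine measurable_of_tendsto_metrizable (f := fun n p => k (Z (d n p.1) p.2))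
    (fun n => ?_) (tendsto_pi_nhds.2 fun p => ?_)
  · have h1 : ∀ (w : ℕ → ℝ≥0) (c : ℝ≥0 → ℕ), Measurable c →
        Measurable fun p : ℝ≥0 × Ω => k (Z (w (c p.1)) p.2) := by
      intro w c hc
      have h2 : Measurable fun q : ℕ × Ω => k (Z (w q.1) q.2) :=
        measurable_from_prod_countable_right fun j => hk.comp (hZm (w j))
      have h3 : Measurable fun p : ℝ≥0 × Ω => (c p.1, p.2) :=
        (hc.comp measurable_fst).prodMk measurable_snd
      exact h2.comp h3
    exact h1 (fun j => ((j : ℝ≥0) + 1) / ((n : ℝ≥0) + 1)) (fun t => ⌊((n : ℝ≥0) + 1) * t⌋₊)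
      (Nat.measurable_floor.comp (measurable_const_mul _))
  · have hd1 : ∀ n, p.1 ≤ d n p.1 := by
      intro n
      rw [le_div_iff₀ (by positivity), mul_comm]
      exact (Nat.lt_floor_add_one _).le
    have hd2 : ∀ n, d n p.1 ≤ p.1 + 1 / ((n : ℝ≥0) + 1) := by
      intro n
      have hn : ((n : ℝ≥0) + 1) ≠ 0 := by positivity
      rw [div_le_iff₀ (by positivity), add_mul p.1, one_div, inv_mul_cancel₀ hn, mul_comm p.1]
      gcongr
      exact Nat.floor_le bot_le
    have hlim : Tendsto (fun n => d n p.1) atTop (𝓝 p.1) := by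
      refine tendsto_of_tendsto_of_tendsto_of_le_of_le tendsto_const_nhds ?_ hd1 hd2
      have := (tendsto_const_nhds (x := p.1) (f := atTop (α := ℕ))).add
        (NNReal.tendsto_coe.1 (by
          simpa using tendsto_one_div_add_atTop_nhds_zero_nat (𝕜 := ℝ)) :
          Tendsto (fun n : ℕ => 1 / ((n : ℝ≥0) + 1)) atTop (𝓝 0))
      simpa using this
    have hw : Tendsto (fun n => d n p.1) atTop (𝓝[≥] p.1) :=
      tendsto_nhdsWithin_iff.2 ⟨hlim, Eventually.of_forall hd1⟩
    refine tendsto_nhds_of_eventually_eq ?_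
    filter_upwards [hw.eventually (hZr p.2 p.1)] with n hn
    rw [hn]

variable {lam : Measure X} {ξ : Multiset X} {P : Measure Ω} {Z : ℝ≥0 → Ω → Multiset X}

theorem IsImmigrationDeathProcess.measurable (hZ : IsImmigrationDeathProcess lam ξ P Z)
    (t : ℝ≥0) : Measurable (Z t) := by
  obtain ⟨ℱ, hm, -⟩ := hZ.martingale
  exact (hm t).mono (ℱ.le t) le_rfl

theorem IsImmigrationDeathProcess.measurable_uncurry (hZ : IsImmigrationDeathProcess lam ξ P Z)
    {k : Multiset X → ℝ} (hk : Measurable k) :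
    Measurable fun p : ℝ≥0 × Ω => k (Z p.1 p.2) :=
  measurable_uncurry_of_right_continuous hZ.measurable hZ.right_continuous hk

theorem IsImmigrationDeathProcess.measurable_uncurry_toNNReal
    (hZ : IsImmigrationDeathProcess lam ξ P Z) {k : Multiset X → ℝ} (hk : Measurable k) :
    Measurable fun p : ℝ × Ω => k (Z p.1.toNNReal p.2) :=
  (hZ.measurable_uncurry hk).comp (f := fun p : ℝ × Ω => (p.1.toNNReal, p.2))
    ((measurable_real_toNNReal.comp measurable_fst).prodMk measurable_snd)

theorem IsImmigrationDeathProcess.integrable_comp (hZ : IsImmigrationDeathProcess lam ξ P Z)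
    {k : Multiset X → ℝ} (hk : Measurable k) {C : ℝ} (hC : ∀ η, |k η| ≤ C) (t : ℝ≥0) :
    Integrable (fun ω => k (Z t ω)) P :=
  have := hZ.isProbabilityMeasure
  Integrable.of_bound (hk.comp (hZ.measurable t)).aestronglyMeasurable C
    (Eventually.of_forall fun ω => hC (Z t ω))

theorem IsImmigrationDeathProcess.abs_integral_comp_le
    (hZ : IsImmigrationDeathProcess lam ξ P Z)
    {k : Multiset X → ℝ} {C : ℝ} (hC : ∀ η, |k η| ≤ C) (t : ℝ≥0) :
    |∫ ω, k (Z t ω) ∂P| ≤ C := by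
  have := hZ.isProbabilityMeasure
  have h := norm_integral_le_of_norm_le_const (μ := P) (f := fun ω => k (Z t ω)) (C := C)
    (Eventually.of_forall fun ω => hC (Z t ω))
  simpa using h

theorem IsImmigrationDeathProcess.measurable_integral_comp
    (hZ : IsImmigrationDeathProcess lam ξ P Z) {k : Multiset X → ℝ} (hk : Measurable k) :
    Measurable fun s : ℝ => ∫ ω, k (Z s.toNNReal ω) ∂P := by
  have := hZ.isProbabilityMeasure
  exact ((hZ.measurable_uncurry_toNNReal hk).stronglyMeasurable.integral_prod_right'
    (ν := P)).measurable

theorem IsImmigrationDeathProcess.intervalIntegrable_integral_comp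
    (hZ : IsImmigrationDeathProcess lam ξ P Z) {k : Multiset X → ℝ} (hk : Measurable k)
    {C : ℝ} (hC : ∀ η, |k η| ≤ C) (a b : ℝ) :
    IntervalIntegrable (fun s : ℝ => ∫ ω, k (Z s.toNNReal ω) ∂P) volume a b := by
  rw [intervalIntegrable_iff]
  have : IsFiniteMeasure (volume.restrict (Set.uIoc a b)) :=
    ⟨by simp [Set.uIoc]⟩
  exact Integrable.of_bound (hZ.measurable_integral_comp hk).aestronglyMeasurable C
    (Eventually.of_forall fun s => hZ.abs_integral_comp_le hC _)

/-- Dynkin's formula for bounded functions with bounded generator. -/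
theorem IsImmigrationDeathProcess.dynkin (hZ : IsImmigrationDeathProcess lam ξ P Z)
    {h : Multiset X → ℝ} (hm : Measurable h) {C : ℝ} (hC : ∀ η, |h η| ≤ C)
    (gm : Measurable (generator lam h)) {K : ℝ} (hK : ∀ η, |generator lam h η| ≤ K) (t : ℝ≥0) :
    ∫ ω, h (Z t ω) ∂P
      = h ξ + ∫ s in (0 : ℝ)..t, ∫ ω, generator lam h (Z s.toNNReal ω) ∂P := by
  have := hZ.isProbabilityMeasure
  obtain ⟨ℱ, -, hM⟩ := hZ.martingale
  have hmart := hM h hm ⟨C, hC⟩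
  have h1 := hmart.setIntegral_eq (zero_le : (0 : ℝ≥0) ≤ t) (MeasurableSet.univ)
  simp only [Measure.restrict_univ, NNReal.coe_zero, intervalIntegral.integral_same, sub_self,
    integral_zero] at h1
  have hfin : IsFiniteMeasure (volume.restrict (Set.Ioc (0 : ℝ) t)) := ⟨by simp⟩
  have hprod : Integrable (fun p : Ω × ℝ => generator lam h (Z p.2.toNNReal p.1))
      (P.prod (volume.restrict (Set.Ioc (0 : ℝ) t))) :=
    Integrable.of_bound
      ((hZ.measurable_uncurry_toNNReal gm).comp measurable_swap).aestronglyMeasurable K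
      (Eventually.of_forall fun p => hK _)
  have hI : Integrable (fun ω => ∫ s in (0 : ℝ)..t, generator lam h (Z s.toNNReal ω)) P := by
    simp only [intervalIntegral.integral_of_le t.coe_nonneg]
    exact hprod.integral_prod_left
  have hswap : ∫ ω, (∫ s in (0 : ℝ)..t, generator lam h (Z s.toNNReal ω)) ∂P
      = ∫ s in (0 : ℝ)..t, ∫ ω, generator lam h (Z s.toNNReal ω) ∂P := by
    simp only [intervalIntegral.integral_of_le t.coe_nonneg]
    exact integral_integral_swap (f := fun ω s => generator lam h (Z (Real.toNNReal s) ω)) hprod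
  have hI2 : Integrable (fun ω => h (Z t ω) - h (Z 0 ω)) P :=
    (hZ.integrable_comp hm hC t).sub (hZ.integrable_comp hm hC 0)
  rw [integral_sub hI2 hI,
    integral_sub (hZ.integrable_comp hm hC t) (hZ.integrable_comp hm hC 0), hswap] at h1
  have h0 : ∫ ω, h (Z 0 ω) ∂P = h ξ := by
    rw [integral_congr_ae (g := fun _ => h ξ) (by
      filter_upwards [hZ.initial] with ω hω
      rw [hω])]
    simp
  linarith

/-- Right-continuity of `(r, s) ↦ 𝔼 K(r, Z(s))`, jointly with continuity in the parameter. -/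
theorem IsImmigrationDeathProcess.tendsto_integral_right
    (hZ : IsImmigrationDeathProcess lam ξ P Z) {K : ℝ → Multiset X → ℝ}
    (hm : ∀ r, Measurable (K r)) {C : ℝ} {r : ℝ} (hC : ∀ᶠ q in 𝓝 r, ∀ η, |K q η| ≤ C)
    (hc : ∀ η, Continuous fun r => K r η) (s : ℝ) :
    Tendsto (fun q : ℝ × ℝ => ∫ ω, K q.1 (Z q.2.toNNReal ω) ∂P) (𝓝 r ×ˢ 𝓝[≥] s)
      (𝓝 (∫ ω, K r (Z s.toNNReal ω) ∂P)) := by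
  have := hZ.isProbabilityMeasure
  refine tendsto_integral_filter_of_dominated_convergence (fun _ => C)
    (Eventually.of_forall fun q => ((hm _).comp (hZ.measurable _)).aestronglyMeasurable)
    ((tendsto_fst.eventually hC).mono fun q hq => Eventually.of_forall fun ω => hq _)
    (integrable_const _) (Eventually.of_forall fun ω => ?_)
  have h1 : Tendsto Real.toNNReal (𝓝[≥] s) (𝓝[≥] s.toNNReal) := by
    refine tendsto_nhdsWithin_iff.2
      ⟨(continuous_real_toNNReal.tendsto s).mono_left nhdsWithin_le_nhds, ?_⟩
    filter_upwards [self_mem_nhdsWithin] with x hx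
    exact Real.toNNReal_mono hx
  have h2 := (tendsto_snd (f := 𝓝 r) (g := 𝓝[≥] s)).eventually
    (h1.eventually (hZ.right_continuous ω s.toNNReal))
  have h3 : Tendsto (fun q : ℝ × ℝ => K q.1 (Z s.toNNReal ω)) (𝓝 r ×ˢ 𝓝[≥] s)
      (𝓝 (K r (Z s.toNNReal ω))) := ((hc _).tendsto r).comp tendsto_fst
  refine h3.congr' ?_
  filter_upwards [h2] with q hq
  rw [hq]

end Dynkin

/-! ### Generating functional of the process via the backward equation -/

section GeneratingFunctional

variable {X : Type*} [MeasurableSpace X] {Ω : Type*} [MeasurableSpace Ω]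
variable {lam : Measure X} {ξ : Multiset X} {P : Measure Ω}
variable {Z : ℝ≥0 → Ω → Multiset X}

/-- The Poisson factor of the generating functional at time `r`. -/
noncomputable def immigrationFactor (lam : Measure X) (u : X → ℝ) (r : ℝ) : ℝ :=
  Real.exp (-((1 - Real.exp (-r)) * ∫ x, (1 - u x) ∂lam))

theorem immigrationFactor_mem_Icc {u : X → ℝ} (h1 : ∀ x, u x ≤ 1) {r : ℝ} (hr : 0 ≤ r) :
    immigrationFactor lam u r ∈ Set.Icc (0 : ℝ) 1 := by
  refine ⟨(Real.exp_pos _).le, Real.exp_le_one_iff.2 ?_⟩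
  have hL : 0 ≤ ∫ x, (1 - u x) ∂lam := integral_nonneg fun x => sub_nonneg.2 (h1 x)
  have hq : 0 ≤ 1 - Real.exp (-r) := sub_nonneg.2 (Real.exp_le_one_iff.2 (by linarith))
  nlinarith [mul_nonneg hq hL]

/-- The backward generating functional at time `r`, as a function of the initial state. -/
noncomputable def backwardFunctional (lam : Measure X) (u : X → ℝ) (r : ℝ) (η : Multiset X) : ℝ :=
  immigrationFactor lam u r * prodFunctional (thinFunction (Real.exp (-r)) u) η

/-- The time derivative of `backwardFunctional`. -/
noncomputable def backwardDeriv (lam : Measure X) (u : X → ℝ) (r : ℝ) (η : Multiset X) : ℝ :=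
  immigrationFactor lam u r * generator lam (prodFunctional (thinFunction (Real.exp (-r)) u)) η

theorem generator_prodFunctional_thin (u : X → ℝ) (p : ℝ) (η : Multiset X) :
    generator lam (prodFunctional (thinFunction p u)) η
      = prodFunctional (thinFunction p u) η * (-p * ∫ x, (1 - u x) ∂lam)
        + removalSum (thinFunction p u) η := by
  have h : ∀ x, thinFunction p u x - 1 = -p * (1 - u x) := fun x => by
    rw [thinFunction]; ring
  simp only [generator_prodFunctional, h, integral_const_mul]

/-- This is the backward equation: the derivative of the immigration factor supplies the birth part
of the generator, and that of the thinned product supplies the death part. -/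
theorem hasDerivAt_backwardFunctional (u : X → ℝ) (η : Multiset X) (r : ℝ) :
    HasDerivAt (fun r => backwardFunctional lam u r η) (backwardDeriv lam u r η) r := by
  have h1 : HasDerivAt (immigrationFactor lam u)
      (immigrationFactor lam u r * (-Real.exp (-r) * ∫ x, (1 - u x) ∂lam)) r := by
    have := (((((hasDerivAt_neg r).exp).const_sub 1).mul_const (∫ x, (1 - u x) ∂lam)).neg).exp
    refine this.congr_deriv ?_
    simp only [immigrationFactor, Pi.neg_apply]
    ring
  have h2 := h1.mul (hasDerivAt_prodFunctional_thin u η r)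
  refine h2.congr_deriv ?_
  rw [backwardDeriv, generator_prodFunctional_thin]
  ring

theorem continuous_backwardDeriv (u : X → ℝ) (η : Multiset X) :
    Continuous fun r => backwardDeriv lam u r η := by
  simp only [backwardDeriv, generator_prodFunctional_thin]
  have he : Continuous fun r : ℝ => Real.exp (-r) := by fun_prop
  have h1 := (continuous_prodFunctional_thin u η).comp he
  have h2 := (continuous_removalSum_thin u η).comp he
  unfold immigrationFactor
  simp only [Function.comp_def] at h1 h2
  fun_prop

theorem measurable_generator_prodFunctional {u : X → ℝ} (hu : Measurable u) :
    Measurable (generator lam (prodFunctional u)) := by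
  have h : generator lam (prodFunctional u)
      = fun ξ => prodFunctional u ξ * ∫ x, (u x - 1) ∂lam + removalSum u ξ :=
    funext fun ξ => generator_prodFunctional lam u ξ
  rw [h]
  exact ((measurable_prodFunctional hu).mul_const _).add (measurable_removalSum hu)

theorem abs_generator_prodFunctional_thin_le {u : X → ℝ} (h0 : ∀ x, 0 ≤ u x)
    (h1 : ∀ x, u x ≤ 1) {p : ℝ} (hp0 : 0 ≤ p) (hp1 : p ≤ 1) (η : Multiset X) :
    |generator lam (prodFunctional (thinFunction p u)) η| ≤ ∫ x, (1 - u x) ∂lam + 1 := by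
  have hL : 0 ≤ ∫ x, (1 - u x) ∂lam := integral_nonneg fun x => sub_nonneg.2 (h1 x)
  have ht0 := thinFunction_nonneg hp0 hp1 h0
  have ht1 := thinFunction_le_one hp0 h1
  have hr := removalSum_mem_Icc ht0 ht1 η
  have hq0 := prodFunctional_nonneg ht0 η
  have hq1 := prodFunctional_le_one ht0 ht1 η
  rw [generator_prodFunctional_thin]
  have hpq0 : 0 ≤ prodFunctional (thinFunction p u) η * p := mul_nonneg hq0 hp0
  have hpq1 : prodFunctional (thinFunction p u) η * p ≤ 1 := mul_le_one₀ hq1 hp0 hp1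
  have h3 := mul_nonneg hpq0 hL
  have h4 := mul_le_mul_of_nonneg_right hpq1 hL
  rw [abs_le]
  constructor <;> nlinarith [hr.1, hr.2]

theorem abs_backwardDeriv_le {u : X → ℝ} (h0 : ∀ x, 0 ≤ u x) (h1 : ∀ x, u x ≤ 1) {r : ℝ}
    (hr : 0 ≤ r) (η : Multiset X) :
    |backwardDeriv lam u r η| ≤ ∫ x, (1 - u x) ∂lam + 1 := by
  have he := immigrationFactor_mem_Icc (lam := lam) h1 hr
  rw [backwardDeriv, abs_mul, abs_of_nonneg he.1]
  exact (mul_le_of_le_one_left (abs_nonneg _) he.2).trans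
    (abs_generator_prodFunctional_thin_le h0 h1 (Real.exp_pos _).le
      (Real.exp_le_one_iff.2 (by linarith)) η)

theorem abs_backwardFunctional_le {u : X → ℝ} (h0 : ∀ x, 0 ≤ u x) (h1 : ∀ x, u x ≤ 1) {r : ℝ}
    (hr : 0 ≤ r) (η : Multiset X) : |backwardFunctional lam u r η| ≤ 1 := by
  have he := immigrationFactor_mem_Icc (lam := lam) h1 hr
  rw [backwardFunctional, abs_mul, abs_of_nonneg he.1]
  have hp0 := (Real.exp_pos (-r)).le
  exact mul_le_one₀ he.2 (abs_nonneg _) (abs_prodFunctional_le_one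
    (thinFunction_nonneg hp0 (Real.exp_le_one_iff.2 (by linarith)) h0)
    (thinFunction_le_one hp0 h1) η)

theorem abs_backwardFunctional_sub_le {u : X → ℝ} (h0 : ∀ x, 0 ≤ u x) (h1 : ∀ x, u x ≤ 1)
    {r q : ℝ} (hr : 0 ≤ r) (hq : 0 ≤ q) (η : Multiset X) :
    |backwardFunctional lam u r η - backwardFunctional lam u q η|
      ≤ (∫ x, (1 - u x) ∂lam + 1) * |r - q| :=
  (convex_Ici (0 : ℝ)).norm_image_sub_le_of_norm_hasDerivWithin_le
    (fun x _ => (hasDerivAt_backwardFunctional u η x).hasDerivWithinAt)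
    (fun _ hx => abs_backwardDeriv_le h0 h1 hx η) hq hr

theorem measurable_backwardFunctional {u : X → ℝ} (hu : Measurable u) (r : ℝ) :
    Measurable (backwardFunctional lam u r) :=
  (measurable_prodFunctional (measurable_thinFunction hu _)).const_mul _

theorem measurable_backwardDeriv {u : X → ℝ} (hu : Measurable u) (r : ℝ) :
    Measurable (backwardDeriv lam u r) :=
  (measurable_generator_prodFunctional (measurable_thinFunction hu _)).const_mul _

theorem IsImmigrationDeathProcess.integral_backwardFunctional_sub
    (hZ : IsImmigrationDeathProcess lam ξ P Z) {u : X → ℝ} (hu : Measurable u)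
    (h0 : ∀ x, 0 ≤ u x) (h1 : ∀ x, u x ≤ 1) {r a b : ℝ} (hr : 0 ≤ r) (ha : 0 ≤ a)
    (hb : 0 ≤ b) :
    ∫ ω, backwardFunctional lam u r (Z b.toNNReal ω) ∂P
        - ∫ ω, backwardFunctional lam u r (Z a.toNNReal ω) ∂P
      = ∫ s in a..b, ∫ ω, backwardDeriv lam u r (Z s.toNNReal ω) ∂P := by
  have hp0 := (Real.exp_pos (-r)).le
  have hp1 : Real.exp (-r) ≤ 1 := Real.exp_le_one_iff.2 (by linarith)
  have hm := measurable_thinFunction hu (Real.exp (-r))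
  have gm := measurable_generator_prodFunctional (lam := lam) hm
  have gb := abs_generator_prodFunctional_thin_le (lam := lam) h0 h1 hp0 hp1
  have key := hZ.dynkin (measurable_prodFunctional hm) (abs_prodFunctional_le_one
    (thinFunction_nonneg hp0 hp1 h0) (thinFunction_le_one hp0 h1)) gm gb
  have hbk := key b.toNNReal
  have hak := key a.toNNReal
  rw [Real.coe_toNNReal b hb] at hbk
  rw [Real.coe_toNNReal a ha] at hak
  simp only [backwardFunctional, backwardDeriv, integral_const_mul,
    intervalIntegral.integral_const_mul]
  rw [hbk, hak, ← intervalIntegral.integral_interval_sub_left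
    (hZ.intervalIntegrable_integral_comp gm gb 0 b)
    (hZ.intervalIntegrable_integral_comp gm gb 0 a)]
  ring

theorem IsImmigrationDeathProcess.hasDerivAt_integral_backwardFunctional
    (hZ : IsImmigrationDeathProcess lam ξ P Z) {u : X → ℝ} (hu : Measurable u)
    (h0 : ∀ x, 0 ≤ u x) (h1 : ∀ x, u x ≤ 1) {r : ℝ} (hr : 0 < r) (t : ℝ≥0) :
    HasDerivAt (fun r => ∫ ω, backwardFunctional lam u r (Z t ω) ∂P)
      (∫ ω, backwardDeriv lam u r (Z t ω) ∂P) r := by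
  have := hZ.isProbabilityMeasure
  exact (hasDerivAt_integral_of_dominated_loc_of_deriv_le (Ioi_mem_nhds hr)
    (Eventually.of_forall fun r =>
      ((measurable_backwardFunctional hu r).comp (hZ.measurable t)).aestronglyMeasurable)
    (hZ.integrable_comp (measurable_backwardFunctional hu r)
      (abs_backwardFunctional_le h0 h1 hr.le) t)
    ((measurable_backwardDeriv hu r).comp (hZ.measurable t)).aestronglyMeasurable
    (Eventually.of_forall fun ω x hx => abs_backwardDeriv_le h0 h1 (le_of_lt hx) (Z t ω))
    (integrable_const _)
    (Eventually.of_forall fun ω x _ => hasDerivAt_backwardFunctional u (Z t ω) x)).2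

/-- Moving the state forward by `dx` gains the generator term, while shortening the remaining time
`T - x` loses the same term. Only a right derivative is claimed, since the paths supply
right-continuity of the expectations. -/
theorem IsImmigrationDeathProcess.hasDerivWithinAt_integral_backwardFunctional
    (hZ : IsImmigrationDeathProcess lam ξ P Z) {u : X → ℝ} (hu : Measurable u)
    (h0 : ∀ x, 0 ≤ u x) (h1 : ∀ x, u x ≤ 1) {T s : ℝ} (hs : s ∈ Set.Ico 0 T) :
    HasDerivWithinAt (fun x => ∫ ω, backwardFunctional lam u (T - x) (Z x.toNNReal ω) ∂P) 0
      (Set.Ici s) s := by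
  have hTs : 0 < T - s := sub_pos.2 hs.2
  rw [hasDerivWithinAt_iff_isLittleO, Asymptotics.isLittleO_iff]
  intro ε hε
  have hε2 : 0 < ε / 2 := half_pos hε
  set κ := ∫ ω, backwardDeriv lam u (T - s) (Z s.toNNReal ω) ∂P with hκ
  have hd : HasDerivAt (fun x => ∫ ω, backwardFunctional lam u (T - x) (Z s.toNNReal ω) ∂P)
      (-κ) s := by
    have := (hZ.hasDerivAt_integral_backwardFunctional hu h0 h1 hTs s.toNNReal).comp s
      ((hasDerivAt_id s).const_sub T)
    simpa [Function.comp_def] using this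
  have hd' := (Asymptotics.isLittleO_iff.1 (hasDerivAt_iff_isLittleO.1 hd)) hε2
  have ht := hZ.tendsto_integral_right (K := backwardDeriv lam u) (measurable_backwardDeriv hu)
    (r := T - s) ((eventually_gt_nhds hTs).mono fun q hq => abs_backwardDeriv_le h0 h1 hq.le)
    (continuous_backwardDeriv u) s
  have ht' := (Metric.tendsto_nhds.1 ht) (ε / 2) hε2
  obtain ⟨pa, hpa, pb, hpb, hpab⟩ := Filter.eventually_prod_iff.1 ht'
  have hTx : Tendsto (fun x => T - x) (𝓝[≥] s) (𝓝 (T - s)) :=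
    ((continuous_const.sub continuous_id).tendsto s).mono_left nhdsWithin_le_nhds
  obtain ⟨v, hv, hsv⟩ := (mem_nhdsGE_iff_exists_Ico_subset).1 hpb
  filter_upwards [nhdsWithin_le_nhds hd', hTx.eventually hpa,
    nhdsWithin_le_nhds (Iio_mem_nhds hs.2), Ico_mem_nhdsGE hv] with x hx1 hx2 hx3 hx4
  have hx0 : 0 ≤ x := hs.1.trans hx4.1
  have hxT : 0 ≤ T - x := sub_nonneg.2 (le_of_lt hx3)
  have hdyn := hZ.integral_backwardFunctional_sub hu h0 h1 hxT hs.1 hx0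
  -- The increment is split at (remaining time `T - x`, state at time `s`). The change of state
  -- contributes `κ (x - s)` by Dynkin, the change of remaining time contributes `-κ (x - s)`, each
  -- up to `ε/2 · |x - s|`.
  have hint : ‖∫ y in s..x, ((∫ ω, backwardDeriv lam u (T - x) (Z y.toNNReal ω) ∂P) - κ)‖
      ≤ ε / 2 * |x - s| := by
    refine intervalIntegral.norm_integral_le_of_norm_le_const fun y hy => ?_
    rw [Set.uIoc_of_le hx4.1] at hy
    have := hpab hx2 (hsv ⟨hy.1.le, hy.2.trans_lt hx4.2⟩)
    rw [Real.dist_eq] at this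
    exact this.le
  rw [intervalIntegral.integral_sub (hZ.intervalIntegrable_integral_comp
      (measurable_backwardDeriv hu _) (abs_backwardDeriv_le h0 h1 hxT) s x)
      intervalIntegrable_const, intervalIntegral.integral_const, ← hdyn, smul_eq_mul] at hint
  simp only [smul_eq_mul, mul_zero, sub_zero, Real.norm_eq_abs] at hx1 hint ⊢
  have hsum := (abs_add_le _ _).trans (add_le_add hint hx1)
  refine le_trans (le_of_eq ?_) (hsum.trans (le_of_eq ?_))
  · congr 1; ring
  · ring

/-- The generating functional of the immigration-death process: independent survival of the
initial points together with Poisson immigration. -/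
theorem IsImmigrationDeathProcess.integral_prodFunctional
    (hZ : IsImmigrationDeathProcess lam ξ P Z) {u : X → ℝ} (hu : Measurable u)
    (h0 : ∀ x, 0 ≤ u x) (h1 : ∀ x, u x ≤ 1) (t : ℝ≥0) :
    ∫ ω, prodFunctional u (Z t ω) ∂P
      = immigrationFactor lam u t * prodFunctional (thinFunction (Real.exp (-t)) u) ξ := by
  have := hZ.isProbabilityMeasure
  set C := ∫ x, (1 - u x) ∂lam + 1 with hC
  have hC0 : 0 ≤ C := add_nonneg (integral_nonneg fun x => sub_nonneg.2 (h1 x)) zero_le_one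
  let G : ℝ → ℝ := fun x => ∫ ω, backwardFunctional lam u (t - x) (Z x.toNNReal ω) ∂P
  have hcont : ContinuousOn G (Set.Icc 0 t) := by
    refine (LipschitzOnWith.of_dist_le_mul (K := (2 * C).toNNReal) fun x hx y hy => ?_).continuousOn
    rw [Real.coe_toNNReal _ (by positivity), Real.dist_eq, Real.dist_eq]
    have hx' : 0 ≤ (t : ℝ) - x := sub_nonneg.2 hx.2
    have hy' : 0 ≤ (t : ℝ) - y := sub_nonneg.2 hy.2
    have e1 : |∫ ω, backwardFunctional lam u (t - x) (Z x.toNNReal ω) ∂P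
        - ∫ ω, backwardFunctional lam u (t - x) (Z y.toNNReal ω) ∂P| ≤ C * |x - y| := by
      rw [hZ.integral_backwardFunctional_sub hu h0 h1 hx' hy.1 hx.1]
      rw [← Real.norm_eq_abs]
      refine intervalIntegral.norm_integral_le_of_norm_le_const fun s _ => ?_
      exact hZ.abs_integral_comp_le (abs_backwardDeriv_le h0 h1 hx') _
    have e2 : |∫ ω, backwardFunctional lam u (t - x) (Z y.toNNReal ω) ∂P
        - ∫ ω, backwardFunctional lam u (t - y) (Z y.toNNReal ω) ∂P| ≤ C * |x - y| := by
      rw [← integral_sub (hZ.integrable_comp (measurable_backwardFunctional hu _)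
        (abs_backwardFunctional_le h0 h1 hx') _) (hZ.integrable_comp
        (measurable_backwardFunctional hu _) (abs_backwardFunctional_le h0 h1 hy') _)]
      refine hZ.abs_integral_comp_le (k := fun η => backwardFunctional lam u (t - x) η
        - backwardFunctional lam u (t - y) η) (fun η => ?_) _
      refine (abs_backwardFunctional_sub_le h0 h1 hx' hy' η).trans (le_of_eq ?_)
      rw [abs_sub_comm x y]
      congr 2
      ring
    calc |G x - G y| ≤ _ :=
          abs_sub_le _ (∫ ω, backwardFunctional lam u (t - x) (Z y.toNNReal ω) ∂P) _
      _ ≤ C * |x - y| + C * |x - y| := add_le_add e1 e2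
      _ = 2 * C * |x - y| := by ring
  -- A continuous function with vanishing right derivative is constant; its two endpoint values are
  -- the two sides of the claim.
  have hconst := constant_of_has_deriv_right_zero hcont
    (fun s hs => hZ.hasDerivWithinAt_integral_backwardFunctional hu h0 h1 hs) t
    ⟨t.coe_nonneg, le_rfl⟩
  have hG0 : G 0 = backwardFunctional lam u t ξ := by
    simp only [G, sub_zero, Real.toNNReal_zero]
    rw [integral_congr_ae (g := fun _ => backwardFunctional lam u t ξ) (by
      filter_upwards [hZ.initial] with ω hω
      rw [hω])]
    simp
  have hGt : G t = ∫ ω, prodFunctional u (Z t ω) ∂P := by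
    simp [G, backwardFunctional, immigrationFactor, thinFunction_one]
  rw [← hGt, hconst, hG0, backwardFunctional]

end GeneratingFunctional

end PointPattern

namespace PointPattern

/-! ### Generating functional and comparison of Poisson processes -/

section PoissonLaw

variable {X : Type*} [MeasurableSpace X] (lam : Measure X) [IsFiniteMeasure lam]

theorem integral_prodFunctional_poissonProcess {u : X → ℝ} (hu : Measurable u)
    (h0 : ∀ x, 0 ≤ u x) (h1 : ∀ x, u x ≤ 1) :
    ∫ η, prodFunctional u η ∂(poissonProcess lam) = Real.exp (-∫ x, (1 - u x) ∂lam) := by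
  have hint : Integrable (prodFunctional u) (poissonProcess lam) :=
    Integrable.of_bound (measurable_prodFunctional hu).aestronglyMeasurable 1
      (Eventually.of_forall fun η => abs_prodFunctional_le_one h0 h1 η)
  have hs := hasSum_integral_measure hint
  have hn : ∀ n : ℕ, ∫ η, prodFunctional u η ∂(ENNReal.ofReal
      (Real.exp (-lam.real Set.univ) / n !) • (Measure.pi fun _ : Fin n => lam).map ofTuple)
      = Real.exp (-lam.real Set.univ) * ((∫ x, u x ∂lam) ^ n / n !) := by
    intro n
    rw [integral_smul_measure, integral_map (measurable_ofTuple n).aemeasurable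
      (measurable_prodFunctional hu).aestronglyMeasurable]
    simp only [prodFunctional_ofTuple]
    rw [integral_fintype_prod_eq_pow, Fintype.card_fin, ENNReal.toReal_ofReal (by positivity),
      smul_eq_mul]
    ring
  simp only [hn] at hs
  have hs' := (NormedSpace.expSeries_div_hasSum_exp (∫ x, u x ∂lam)).mul_left
    (Real.exp (-lam.real Set.univ))
  rw [← Real.exp_eq_exp_ℝ, ← Real.exp_add] at hs'
  refine (hs.unique hs').trans ?_
  have hui : Integrable u lam := Integrable.of_bound hu.aestronglyMeasurable 1
    (Eventually.of_forall fun x => by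
      rw [Real.norm_eq_abs, abs_of_nonneg (h0 x)]; exact h1 x)
  rw [integral_sub (integrable_const _) hui, integral_const, smul_eq_mul, mul_one]
  congr 1
  ring

theorem pi_smul_const (c : ℝ≥0) (n : ℕ) :
    (Measure.pi fun _ : Fin n => c • lam) = c ^ n • Measure.pi fun _ : Fin n => lam := by
  refine Measure.pi_eq fun s _ => ?_
  rw [Measure.smul_apply, Measure.pi_pi]
  simp only [Measure.smul_apply, ENNReal.smul_def, smul_eq_mul, Finset.prod_mul_distrib,
    Finset.prod_const, Finset.card_univ, Fintype.card_fin, ENNReal.coe_pow]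

/-- With probability at least `e^{-(1-c)λ}` a Poisson process has no points besides those of its
`c`-thinning. -/
theorem smul_poissonProcess_smul_le {c : ℝ≥0} (hc : c ≤ 1) :
    Real.toNNReal (Real.exp (-((1 - c) * lam.real Set.univ))) • poissonProcess (c • lam)
      ≤ poissonProcess lam := by
  refine Measure.le_iff.2 fun s hs => ?_
  rw [Measure.smul_apply, poissonProcess, poissonProcess, Measure.sum_apply _ hs,
    Measure.sum_apply _ hs, ENNReal.smul_def, smul_eq_mul, ← ENNReal.tsum_mul_left]
  refine ENNReal.tsum_le_tsum fun n => ?_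
  have hreal : (c • lam).real Set.univ = c * lam.real Set.univ := by
    rw [measureReal_def, Measure.smul_apply, ENNReal.smul_def, smul_eq_mul, ENNReal.toReal_mul,
      ENNReal.coe_toReal, ← measureReal_def]
  rw [hreal, pi_smul_const,
    Measure.map_smul, Measure.smul_apply, Measure.smul_apply, Measure.smul_apply]
  simp only [ENNReal.smul_def, smul_eq_mul, ENNReal.coe_pow]
  rw [← mul_assoc, ← mul_assoc]
  refine mul_le_mul_left ?_ _
  rw [← ENNReal.ofReal, ← ENNReal.ofReal_mul (Real.exp_pos _).le, ← mul_div_assoc,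
    ← Real.exp_add]
  have he : -((1 - (c : ℝ)) * lam.real Set.univ) + -(c * lam.real Set.univ)
      = -lam.real Set.univ := by ring
  rw [he]
  refine mul_le_of_le_one_right' ?_
  exact pow_le_one' (by exact_mod_cast hc) n

/-- The two laws share a common part of mass `k = e^{-(1-c)λ}`, so integrals of a function bounded
by one differ by at most `2(1 - k)`, and `1 - k ≤ (1-c)λ`. -/
theorem abs_integral_poissonProcess_sub_le {c : ℝ≥0} (hc : c ≤ 1) {g : Multiset X → ℝ}
    (hg : Measurable g) (hb : ∀ η, |g η| ≤ 1) :
    |∫ η, g η ∂(poissonProcess (c • lam)) - ∫ η, g η ∂(poissonProcess lam)|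
      ≤ 2 * ((1 - c) * lam.real Set.univ) := by
  set k := Real.exp (-((1 - c) * lam.real Set.univ)) with hk
  have hc' : (0 : ℝ) ≤ 1 - c := sub_nonneg.2 (by exact_mod_cast hc)
  have hk1 : 1 - k ≤ (1 - c) * lam.real Set.univ := by
    have := Real.add_one_le_exp (-((1 - c) * lam.real Set.univ)); linarith
  have hk0 : 0 ≤ 1 - k := sub_nonneg.2 (Real.exp_le_one_iff.2 (by
    have := mul_nonneg hc' (measureReal_nonneg (μ := lam) (s := Set.univ)); linarith))
  have hgi : ∀ (ν : Measure (Multiset X)) [IsFiniteMeasure ν], Integrable g ν := fun ν _ =>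
    Integrable.of_bound hg.aestronglyMeasurable 1 (Eventually.of_forall hb)
  have hle := smul_poissonProcess_smul_le lam hc
  have key : ∀ g' : Multiset X → ℝ, Measurable g' → (∀ η, |g' η| ≤ 1) →
      ∫ η, g' η ∂(poissonProcess (c • lam)) - ∫ η, g' η ∂(poissonProcess lam)
        ≤ 2 * (1 - k) := by
    intro g' hg' hb'
    have hgi' : ∀ (ν : Measure (Multiset X)) [IsFiniteMeasure ν], Integrable g' ν := fun ν _ =>
      Integrable.of_bound hg'.aestronglyMeasurable 1 (Eventually.of_forall hb')
    -- The domination of measures applies only to nonnegative integrands, hence the shift by `1`.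
    -- The opposite inequality comes from applying `key` to `-g`.
    have h1 : ∫ η, (1 + g' η) ∂(Real.toNNReal k • poissonProcess (c • lam))
        ≤ ∫ η, (1 + g' η) ∂(poissonProcess lam) :=
      integral_mono_measure hle (Eventually.of_forall fun η => by
        have := (abs_le.1 (hb' η)).1
        simp only [Pi.zero_apply]; linarith)
        ((integrable_const _).add (hgi' _))
    rw [integral_smul_nnreal_measure, integral_add (integrable_const _) (hgi' _),
      integral_add (integrable_const _) (hgi' _), NNReal.smul_def,
      Real.coe_toNNReal _ (Real.exp_pos _).le] at h1
    simp only [integral_const, probReal_univ, smul_eq_mul, mul_one] at h1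
    have h2 : ∫ η, g' η ∂(poissonProcess (c • lam)) ≤ 1 := by
      have := integral_mono (hgi' (poissonProcess (c • lam))) (integrable_const 1)
        fun η => (abs_le.1 (hb' η)).2
      simpa using this
    nlinarith
  have h1 := key g hg hb
  have h2 := key (fun η => -g η) hg.neg fun η => by rw [abs_neg]; exact hb η
  rw [integral_neg, integral_neg] at h2
  rw [abs_le]
  constructor <;> linarith

end PoissonLaw

/-! ### Laws of the process at a fixed time -/

section Laws

variable {X : Type*} [MeasurableSpace X] {lam : Measure X} {Ω Ω' : Type*} [MeasurableSpace Ω]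
  [MeasurableSpace Ω'] {ξ : Multiset X} {P : Measure Ω} {Z : ℝ≥0 → Ω → Multiset X}
  {P' : Measure Ω'} {Z' : ℝ≥0 → Ω' → Multiset X}

theorem exp_neg_coe_mem_Icc (t : ℝ≥0) : Real.exp (-(t : ℝ)) ∈ Set.Icc (0 : ℝ) 1 :=
  ⟨(Real.exp_pos _).le, Real.exp_le_one_iff.2 (by simp)⟩

/-- Started from the empty configuration, the process is a Poisson process at each time. -/
theorem IsImmigrationDeathProcess.map_eq_poisson [IsFiniteMeasure lam]
    (hZ : IsImmigrationDeathProcess lam 0 P Z) (t : ℝ≥0) :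
    P.map (Z t) = poissonProcess (Real.toNNReal (1 - Real.exp (-(t : ℝ))) • lam) := by
  have := hZ.isProbabilityMeasure
  have := Measure.isProbabilityMeasure_map (μ := P) (hZ.measurable t).aemeasurable
  refine ext_of_forall_integral_prodFunctional fun u hu h0 h1 => ?_
  rw [integral_map (hZ.measurable t).aemeasurable
    (measurable_prodFunctional hu).aestronglyMeasurable, hZ.integral_prodFunctional hu h0 h1,
    integral_prodFunctional_poissonProcess _ hu h0 h1, integral_smul_nnreal_measure,
    prodFunctional_zero, mul_one, immigrationFactor, NNReal.smul_def,
    Real.coe_toNNReal _ (sub_nonneg.2 (exp_neg_coe_mem_Icc t).2), smul_eq_mul]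

/-- Adding a point to the initial configuration adds that point, if it still lives, to the
configuration at time `t`. -/
theorem IsImmigrationDeathProcess.map_cons {α : X} (hZ : IsImmigrationDeathProcess lam ξ P Z)
    (hZ' : IsImmigrationDeathProcess lam (α ::ₘ ξ) P' Z') (t : ℝ≥0) :
    P'.map (Z' t) = Real.toNNReal (Real.exp (-(t : ℝ))) • (P.map fun ω => α ::ₘ Z t ω)
      + Real.toNNReal (1 - Real.exp (-(t : ℝ))) • P.map (Z t) := by
  have := hZ.isProbabilityMeasure
  have := hZ'.isProbabilityMeasure
  have hc : Measurable fun ω => α ::ₘ Z t ω := (measurable_cons α).comp (hZ.measurable t)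
  refine ext_of_forall_integral_prodFunctional fun u hu h0 h1 => ?_
  have hi : ∀ (ν : Measure (Multiset X)) [IsFiniteMeasure ν], Integrable (prodFunctional u) ν :=
    fun ν _ => Integrable.of_bound (measurable_prodFunctional hu).aestronglyMeasurable 1
      (Eventually.of_forall fun η => abs_prodFunctional_le_one h0 h1 η)
  have hm := (measurable_prodFunctional hu)
  rw [integral_add_measure (hi _) (hi _), integral_smul_nnreal_measure,
    integral_smul_nnreal_measure, integral_map (hZ'.measurable t).aemeasurable
      hm.aestronglyMeasurable, integral_map hc.aemeasurable hm.aestronglyMeasurable,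
    integral_map (hZ.measurable t).aemeasurable hm.aestronglyMeasurable]
  simp only [prodFunctional_cons]
  rw [integral_const_mul, hZ'.integral_prodFunctional hu h0 h1,
    hZ.integral_prodFunctional hu h0 h1, prodFunctional_cons, NNReal.smul_def, NNReal.smul_def,
    Real.coe_toNNReal _ (sub_nonneg.2 (exp_neg_coe_mem_Icc t).2),
    Real.coe_toNNReal _ (exp_neg_coe_mem_Icc t).1, smul_eq_mul, smul_eq_mul]
  simp only [thinFunction]
  ring

theorem IsImmigrationDeathProcess.integral_cons_sub {α : X}
    (hZ : IsImmigrationDeathProcess lam ξ P Z)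
    (hZ' : IsImmigrationDeathProcess lam (α ::ₘ ξ) P' Z') {k : Multiset X → ℝ}
    (hk : Measurable k) {C : ℝ} (hC : ∀ η, |k η| ≤ C) (t : ℝ≥0) :
    ∫ ω, k (Z' t ω) ∂P' - ∫ ω, k (Z t ω) ∂P
      = Real.exp (-(t : ℝ)) * ∫ ω, firstDiff k (Z t ω) α ∂P := by
  have := hZ.isProbabilityMeasure
  have := hZ'.isProbabilityMeasure
  have hc : Measurable fun ω => α ::ₘ Z t ω := (measurable_cons α).comp (hZ.measurable t)
  have hi : ∀ (ν : Measure (Multiset X)) [IsFiniteMeasure ν], Integrable k ν :=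
    fun ν _ => Integrable.of_bound hk.aestronglyMeasurable C (Eventually.of_forall hC)
  have hi1 : Integrable (fun ω => k (α ::ₘ Z t ω)) P :=
    Integrable.of_bound (hk.comp hc).aestronglyMeasurable C (Eventually.of_forall fun ω => hC _)
  rw [← integral_map (hZ'.measurable t).aemeasurable hk.aestronglyMeasurable, hZ.map_cons hZ' t,
    integral_add_measure (hi _) (hi _), integral_smul_nnreal_measure,
    integral_smul_nnreal_measure, integral_map hc.aemeasurable hk.aestronglyMeasurable,
    integral_map (hZ.measurable t).aemeasurable hk.aestronglyMeasurable, NNReal.smul_def,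
    NNReal.smul_def, Real.coe_toNNReal _ (sub_nonneg.2 (exp_neg_coe_mem_Icc t).2),
    Real.coe_toNNReal _ (exp_neg_coe_mem_Icc t).1, smul_eq_mul, smul_eq_mul]
  simp only [firstDiff]
  rw [integral_sub hi1 (hZ.integrable_comp hk hC t)]
  ring

end Laws

/-! ### Existence and differences of the Stein solution -/

section SteinSolution

variable {X : Type*} [MeasurableSpace X] {lam : Measure X} [IsFiniteMeasure lam] {Ω : Type*}
  [MeasurableSpace Ω] {P : Multiset X → Measure Ω} {Z : Multiset X → ℝ≥0 → Ω → Multiset X}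

theorem measurable_firstDiff {k : Multiset X → ℝ} (hk : Measurable k) (α : X) :
    Measurable fun ξ => firstDiff k ξ α :=
  (hk.comp (measurable_cons α)).sub hk

omit [MeasurableSpace X] in
theorem abs_firstDiff_le {k : Multiset X → ℝ} {C : ℝ} (hC : ∀ η, |k η| ≤ C) (η : Multiset X)
    (α : X) : |firstDiff k η α| ≤ 2 * C := by
  have h := (abs_sub (k (α ::ₘ η)) (k η)).trans (add_le_add (hC _) (hC _))
  rw [firstDiff]
  linarith

/-- From the empty configuration the law at time `t` is Poisson with intensity `(1 - e^{-t}) lam`,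
at distance at most `2 e^{-t} λ` from equilibrium. Each initial point matters only if it survives,
which adds at most `2 e^{-t}`. -/
theorem abs_expectationGap_le (hZ : ∀ ξ, IsImmigrationDeathProcess lam ξ (P ξ) (Z ξ))
    {f : Multiset X → ℝ} (hm : Measurable f) (hb : ∀ η, |f η - f 0| ≤ 1) (ξ : Multiset X)
    (t : ℝ≥0) :
    |expectationGap lam P Z f ξ t|
      ≤ (2 * Multiset.card ξ + 2 * lam.real Set.univ) * Real.exp (-(t : ℝ)) := by
  have hprob := fun ξ => (hZ ξ).isProbabilityMeasure
  set g : Multiset X → ℝ := fun η => f η - f 0 with hg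
  have hgm : Measurable g := hm.sub_const _
  have hfb : ∀ η, |f η| ≤ |f 0| + 1 := fun η => by
    have := abs_add_le (f η - f 0) (f 0)
    rw [sub_add_cancel] at this
    linarith [hb η]
  have hgap : ∀ ξ, expectationGap lam P Z f ξ t
      = ∫ ω, g (Z ξ t ω) ∂(P ξ) - ∫ η, g η ∂(poissonProcess lam) := by
    intro ξ
    have h1 : Integrable f (poissonProcess lam) :=
      Integrable.of_bound hm.aestronglyMeasurable _ (Eventually.of_forall hfb)
    simp only [hg]
    rw [integral_sub ((hZ ξ).integrable_comp hm hfb t) (integrable_const _),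
      integral_sub h1 (integrable_const _), expectationGap]
    simp
  induction ξ using Multiset.induction_on with
  | empty =>
    have hp := exp_neg_coe_mem_Icc t
    have hc : Real.toNNReal (1 - Real.exp (-(t : ℝ))) ≤ 1 := by
      rw [← NNReal.coe_le_coe, Real.coe_toNNReal _ (sub_nonneg.2 hp.2), NNReal.coe_one]
      linarith [hp.1]
    have h := abs_integral_poissonProcess_sub_le lam hc hgm hb
    rw [← (hZ 0).map_eq_poisson t, integral_map ((hZ 0).measurable t).aemeasurable
      hgm.aestronglyMeasurable, Real.coe_toNNReal _ (sub_nonneg.2 hp.2)] at h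
    rw [hgap]
    refine h.trans (le_of_eq ?_)
    simp
    ring
  | cons a ξ ih =>
    have h := (hZ ξ).integral_cons_sub (hZ (a ::ₘ ξ)) hgm hb t
    have he : expectationGap lam P Z f (a ::ₘ ξ) t = expectationGap lam P Z f ξ t
        + Real.exp (-(t : ℝ)) * ∫ ω, firstDiff g (Z ξ t ω) a ∂(P ξ) := by
      rw [hgap, hgap, ← h]; ring
    have h2 : |∫ ω, firstDiff g (Z ξ t ω) a ∂(P ξ)| ≤ 2 * 1 :=
      (hZ ξ).abs_integral_comp_le (k := fun η => firstDiff g η a)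
        (fun η => abs_firstDiff_le hb η a) t
    rw [he]
    refine (abs_add_le _ _).trans ?_
    rw [abs_mul, abs_of_pos (Real.exp_pos _), Multiset.card_cons]
    push_cast
    have := mul_le_mul_of_nonneg_left h2 (Real.exp_pos (-(t : ℝ))).le
    linarith

theorem integrableOn_expectationGap (hZ : ∀ ξ, IsImmigrationDeathProcess lam ξ (P ξ) (Z ξ))
    {f : Multiset X → ℝ} (hm : Measurable f) (hb : ∀ η, |f η - f 0| ≤ 1) (ξ : Multiset X) :
    IntegrableOn (fun t : ℝ => expectationGap lam P Z f ξ t.toNNReal) (Set.Ioi 0) := by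
  refine Integrable.mono' ((integrableOn_exp_neg_Ioi 0).const_mul
    (2 * Multiset.card ξ + 2 * lam.real Set.univ))
    (((hZ ξ).measurable_integral_comp hm).sub_const _).aestronglyMeasurable ?_
  filter_upwards [ae_restrict_mem measurableSet_Ioi] with t ht
  have := abs_expectationGap_le hZ hm hb ξ t.toNNReal
  rwa [Real.coe_toNNReal t (le_of_lt ht)] at this

theorem firstDiff_steinSolution (hZ : ∀ ξ, IsImmigrationDeathProcess lam ξ (P ξ) (Z ξ))
    {f : Multiset X → ℝ} (hm : Measurable f) (hb : ∀ η, |f η - f 0| ≤ 1) (ξ : Multiset X)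
    (α : X) :
    firstDiff (steinSolution lam P Z f) ξ α
      = -∫ t in Set.Ioi (0 : ℝ),
          Real.exp (-t) * ∫ ω, firstDiff f (Z ξ t.toNNReal ω) α ∂(P ξ) := by
  have hfb : ∀ η, |f η| ≤ |f 0| + 1 := fun η => by
    have := abs_add_le (f η - f 0) (f 0)
    rw [sub_add_cancel] at this
    linarith [hb η]
  rw [firstDiff, steinSolution, steinSolution, neg_sub_neg, ← neg_sub, ← integral_sub
    (integrableOn_expectationGap hZ hm hb _) (integrableOn_expectationGap hZ hm hb _)]
  congr 1
  refine setIntegral_congr_fun measurableSet_Ioi fun t ht => ?_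
  have h := (hZ ξ).integral_cons_sub (hZ (α ::ₘ ξ)) hm hfb t.toNNReal
  rw [Real.coe_toNNReal t (le_of_lt ht)] at h
  simp only [expectationGap]
  rw [← h]
  ring

theorem secondDiff_steinSolution (hZ : ∀ ξ, IsImmigrationDeathProcess lam ξ (P ξ) (Z ξ))
    {f : Multiset X → ℝ} (hm : Measurable f) (hb : ∀ η, |f η - f 0| ≤ 1) (ξ : Multiset X)
    (α β : X) :
    secondDiff (steinSolution lam P Z f) ξ α β
      = -∫ t in Set.Ioi (0 : ℝ),
          Real.exp (-t) * (Real.exp (-t) *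
            ∫ ω, secondDiff f (Z ξ t.toNNReal ω) α β ∂(P ξ)) := by
  have hfb : ∀ η, |f η| ≤ |f 0| + 1 := fun η => by
    have := abs_add_le (f η - f 0) (f 0)
    rw [sub_add_cancel] at this
    linarith [hb η]
  have hI := fun ξ => integrableOn_expectationGap hZ hm hb ξ
  have e : secondDiff (steinSolution lam P Z f) ξ α β
      = -∫ t in Set.Ioi (0 : ℝ),
        ((expectationGap lam P Z f (β ::ₘ α ::ₘ ξ) t.toNNReal
          - expectationGap lam P Z f (α ::ₘ ξ) t.toNNReal)
        - (expectationGap lam P Z f (β ::ₘ ξ) t.toNNReal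
          - expectationGap lam P Z f ξ t.toNNReal)) := by
    have h1 : Integrable (fun t : ℝ => expectationGap lam P Z f (β ::ₘ α ::ₘ ξ) t.toNNReal
        - expectationGap lam P Z f (α ::ₘ ξ) t.toNNReal) (volume.restrict (Set.Ioi 0)) :=
      (hI _).sub (hI _)
    have h2 : Integrable (fun t : ℝ => expectationGap lam P Z f (β ::ₘ ξ) t.toNNReal
        - expectationGap lam P Z f ξ t.toNNReal) (volume.restrict (Set.Ioi 0)) :=
      (hI _).sub (hI _)
    rw [integral_sub h1 h2, integral_sub (hI _) (hI _), integral_sub (hI _) (hI _)]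
    simp only [secondDiff, steinSolution]
    ring
  rw [e]
  congr 1
  refine setIntegral_congr_fun measurableSet_Ioi fun t ht => ?_
  have h1 := (hZ (α ::ₘ ξ)).integral_cons_sub (hZ (β ::ₘ α ::ₘ ξ)) hm hfb t.toNNReal
  have h2 := (hZ ξ).integral_cons_sub (hZ (β ::ₘ ξ)) hm hfb t.toNNReal
  -- The second factor `e^{-t}` comes from applying the mixture identity again, now to the test
  -- function `Δf(·; β)`: both added points have to survive.
  have h3 := (hZ ξ).integral_cons_sub (hZ (α ::ₘ ξ)) (measurable_firstDiff hm β)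
    (fun η => abs_firstDiff_le hfb η β) t.toNNReal
  rw [Real.coe_toNNReal t (le_of_lt ht)] at h1 h2 h3
  have h4 : (fun ω => secondDiff f (Z ξ t.toNNReal ω) α β)
      = fun ω => firstDiff (fun η => firstDiff f η β) (Z ξ t.toNNReal ω) α := by
    funext ω
    simp only [secondDiff, firstDiff]
    ring
  rw [h4, ← h3]
  simp only [expectationGap]
  rw [mul_sub, ← h1, ← h2]
  ring

end SteinSolution

end PointPattern

namespace PointPattern

/-! ### Majorants of the generating function of the number of points -/

section CountGeneratingFunction

/-- The probability generating function, at `1 - v`, of the sum of independent binomial `(n, p)`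
and Poisson `((1 - p) l)` variables. -/
noncomputable def countPGF (n : ℕ) (l p v : ℝ) : ℝ :=
  Real.exp (-((1 - p) * (l * v))) * (1 - p * v) ^ n

theorem continuous_countPGF (n : ℕ) (l p : ℝ) : Continuous (countPGF n l p) := by
  unfold countPGF; fun_prop

variable {n : ℕ} {l p v : ℝ}

theorem countPGF_le_exp_immigration (hp : p ∈ Set.Icc (0 : ℝ) 1) (hv : v ∈ Set.Icc (0 : ℝ) 1) :
    countPGF n l p v ≤ Real.exp (-(v * (l * (1 - p)))) := by
  have h0 : 0 ≤ 1 - p * v := by nlinarith [hp.1, hp.2, hv.1, hv.2]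
  have h1 : 1 - p * v ≤ 1 := by nlinarith [mul_nonneg hp.1 hv.1]
  have he : (1 - p) * (l * v) = v * (l * (1 - p)) := by ring
  rw [countPGF, he]
  exact mul_le_of_le_one_right (Real.exp_pos _).le (pow_le_one₀ h0 h1)

theorem countPGF_le_one (hl : 0 ≤ l) (hp : p ∈ Set.Icc (0 : ℝ) 1) (hv : v ∈ Set.Icc (0 : ℝ) 1) :
    countPGF n l p v ≤ 1 :=
  (countPGF_le_exp_immigration hp hv).trans (Real.exp_le_one_iff.2
    (neg_nonpos.2 (mul_nonneg hv.1 (mul_nonneg hl (sub_nonneg.2 hp.2)))))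

theorem countPGF_le_exp (hp : p ∈ Set.Icc (0 : ℝ) 1) (hv : v ∈ Set.Icc (0 : ℝ) 1) :
    countPGF n l p v ≤ Real.exp (-(v * (n * p + l * (1 - p)))) := by
  have h0 : 0 ≤ 1 - p * v := by nlinarith [hp.1, hp.2, hv.1, hv.2]
  have h1 : (1 - p * v) ^ n ≤ Real.exp (-(p * v)) ^ n :=
    pow_le_pow_left₀ h0 (by linarith [Real.add_one_le_exp (-(p * v))]) n
  rw [← Real.exp_nat_mul] at h1
  refine (mul_le_mul_of_nonneg_left h1 (Real.exp_pos _).le).trans (le_of_eq ?_)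
  rw [← Real.exp_add]
  congr 1
  ring

/-- The mean number of points `n p + l (1 - p)` is a convex combination of `n` and `l`, hence at
least their minimum. -/
theorem countPGF_le_exp_min (hp : p ∈ Set.Icc (0 : ℝ) 1) (hv : v ∈ Set.Icc (0 : ℝ) 1) :
    countPGF n l p v ≤ Real.exp (-(v * min (n : ℝ) l)) := by
  refine (countPGF_le_exp hp hv).trans (Real.exp_le_exp.2 (neg_le_neg
    (mul_le_mul_of_nonneg_left ?_ hv.1)))
  have h1 := mul_le_mul_of_nonneg_right (min_le_left (n : ℝ) l) hp.1
  have h2 := mul_le_mul_of_nonneg_right (min_le_right (n : ℝ) l) (sub_nonneg.2 hp.2)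
  linarith

/-- The bound `2 - v ≤ e · e^{-v}` trades the weight for a factor `e` and, as `e^{-v} ≤ e^{-vp}`,
for one more initial point. This is where `|ξ| + 1` in the third second-difference bound comes from.
-/
theorem countPGF_mul_le_exp_succ (hp : p ∈ Set.Icc (0 : ℝ) 1) (hv : v ∈ Set.Icc (0 : ℝ) 1) :
    (2 - v) * countPGF n l p v
      ≤ Real.exp 1 * Real.exp (-(v * ((n + 1) * p + l * (1 - p)))) := by
  have h1 : 2 - v ≤ Real.exp (1 - v) := by linarith [Real.add_one_le_exp (1 - v)]
  refine (mul_le_mul h1 (countPGF_le_exp hp hv) (mul_nonneg (Real.exp_pos _).le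
    (pow_nonneg (by nlinarith [hp.1, hp.2, hv.1, hv.2]) n)) (Real.exp_pos _).le).trans ?_
  rw [← Real.exp_add, ← Real.exp_add, Real.exp_le_exp]
  nlinarith [mul_nonneg hv.1 (sub_nonneg.2 hp.2)]

theorem integral_exp_neg_mul {a : ℝ} (ha : a ≠ 0) :
    ∫ v in (0 : ℝ)..1, Real.exp (-(v * a)) = (1 - Real.exp (-a)) / a := by
  have hd : ∀ v ∈ Set.uIcc (0 : ℝ) 1,
      HasDerivAt (fun v => -Real.exp (-(v * a)) / a) (Real.exp (-(v * a))) v := fun v _ => by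
    have := ((((hasDerivAt_id v).mul_const a).neg.exp).neg).div_const a
    refine this.congr_deriv ?_
    simp only [id, Pi.neg_apply]
    field_simp
  rw [intervalIntegral.integral_eq_sub_of_hasDerivAt hd
    (Continuous.intervalIntegrable (by fun_prop) _ _)]
  simp only [one_mul, zero_mul, neg_zero, Real.exp_zero]
  ring

/-- The convention for the quotient at zero is the value of this integral at `a = 0`, so the
corresponding bound needs no positivity. -/
theorem integral_exp_neg_mul_eq_expQuotient (a : ℝ) :
    ∫ v in (0 : ℝ)..1, Real.exp (-(v * a)) = expQuotient a := by
  rw [expQuotient]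
  split_ifs with ha
  · simp [ha]
  · exact integral_exp_neg_mul ha

theorem integral_exp_neg_mul_le {a : ℝ} (ha : 0 < a) :
    ∫ v in (0 : ℝ)..1, Real.exp (-(v * a)) ≤ 1 / a := by
  rw [integral_exp_neg_mul ha.ne']
  gcongr
  linarith [Real.exp_pos (-a)]

/-- The exact value is `2/a - 1/a² - e^{-a}(1/a - 1/a²)`, and the last bracket is nonnegative
precisely because `a ≥ 1`. -/
theorem integral_two_sub_mul_exp_le {a : ℝ} (ha : 1 ≤ a) :
    ∫ v in (0 : ℝ)..1, (2 - v) * Real.exp (-(v * a)) ≤ 2 / a - 1 / a ^ 2 := by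
  have ha0 : a ≠ 0 := by positivity
  have hd : ∀ v ∈ Set.uIcc (0 : ℝ) 1,
      HasDerivAt (fun v => -((2 - v) / a) * Real.exp (-(v * a)) + Real.exp (-(v * a)) / a ^ 2)
        ((2 - v) * Real.exp (-(v * a))) v := fun v _ => by
    have he := ((hasDerivAt_id v).mul_const a).neg.exp
    have := (((((hasDerivAt_id v).const_sub 2).div_const a).neg).mul he).add (he.div_const (a ^ 2))
    refine this.congr_deriv ?_
    simp only [id, Pi.neg_apply]
    field_simp
    ring
  rw [intervalIntegral.integral_eq_sub_of_hasDerivAt hd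
    (Continuous.intervalIntegrable (by fun_prop) _ _)]
  simp only [one_mul, zero_mul, neg_zero, Real.exp_zero]
  have h1 : 1 / a ^ 2 ≤ 1 / a := by
    apply one_div_le_one_div_of_le (by positivity)
    nlinarith
  have h2 := mul_le_mul_of_nonneg_right h1 (Real.exp_pos (-a)).le
  have h3 : 1 / a ^ 2 * Real.exp (-a) = Real.exp (-a) / a ^ 2 := by ring
  have h4 : 1 / a * Real.exp (-a) = (2 - 1) / a * Real.exp (-a) := by norm_num
  rw [h3, h4] at h2
  have h5 : (2 - 0) / a = 2 / a := by norm_num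
  rw [h5]
  linarith

theorem exp_neg_le_quadratic {x : ℝ} (hx : 0 ≤ x) : Real.exp (-x) ≤ 1 - x + x ^ 2 / 2 := by
  have h := Real.quadratic_le_exp_of_nonneg hx
  rw [Real.exp_neg, inv_le_comm₀ (Real.exp_pos x) (by nlinarith [sq_nonneg (x - 1)])]
  refine le_trans ?_ h
  rw [inv_le_iff_one_le_mul₀ (by nlinarith [sq_nonneg (x - 1)])]
  -- Here `(1 - x + x²/2)(1 + x + x²/2) = 1 + x⁴/4 ≥ 1`.
  nlinarith [sq_nonneg (x ^ 2)]

theorem integral_exp_neg_mul_le_quadratic {a : ℝ} (ha : 0 ≤ a) :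
    ∫ v in (0 : ℝ)..1, Real.exp (-(v * a)) ≤ 1 - a / 2 + a ^ 2 / 6 := by
  have h := intervalIntegral.integral_mono_on (μ := volume) (zero_le_one' ℝ)
    (f := fun v => Real.exp (-(v * a))) (g := fun v => 1 - v * a + (v * a) ^ 2 / 2)
    (Continuous.intervalIntegrable (by fun_prop) _ _)
    (Continuous.intervalIntegrable (by fun_prop) _ _)
    fun v hv => exp_neg_le_quadratic (mul_nonneg hv.1 ha)
  refine h.trans (le_of_eq ?_)
  have hd : ∀ v ∈ Set.uIcc (0 : ℝ) 1,
      HasDerivAt (fun v => v - v ^ 2 * (a / 2) + v ^ 3 * (a ^ 2 / 6))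
        (1 - v * a + (v * a) ^ 2 / 2) v := fun v _ => by
    have := ((hasDerivAt_id v).sub ((hasDerivAt_pow 2 v).mul_const (a / 2))).add
      ((hasDerivAt_pow 3 v).mul_const (a ^ 2 / 6))
    refine this.congr_deriv ?_
    push_cast
    ring
  rw [intervalIntegral.integral_eq_sub_of_hasDerivAt hd
    (Continuous.intervalIntegrable (by fun_prop) _ _)]
  ring

theorem integral_two_sub_mul_exp_le_quadratic {a : ℝ} (ha : 0 ≤ a) :
    ∫ v in (0 : ℝ)..1, (2 - v) * Real.exp (-(v * a)) ≤ 3 / 2 - 2 * a / 3 + 5 * a ^ 2 / 24 := by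
  have h := intervalIntegral.integral_mono_on (μ := volume) (zero_le_one' ℝ)
    (f := fun v => (2 - v) * Real.exp (-(v * a)))
    (g := fun v => (2 - v) * (1 - v * a + (v * a) ^ 2 / 2))
    (Continuous.intervalIntegrable (by fun_prop) _ _)
    (Continuous.intervalIntegrable (by fun_prop) _ _)
    fun v hv => mul_le_mul_of_nonneg_left (exp_neg_le_quadratic (mul_nonneg hv.1 ha))
      (by linarith [hv.2])
  refine h.trans (le_of_eq ?_)
  have hd : ∀ v ∈ Set.uIcc (0 : ℝ) 1,
      HasDerivAt (fun v => 2 * v - v ^ 2 * (a + 1 / 2) + v ^ 3 * (a / 3 + a ^ 2 / 3)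
        - v ^ 4 * (a ^ 2 / 8)) ((2 - v) * (1 - v * a + (v * a) ^ 2 / 2)) v := fun v _ => by
    have := ((((hasDerivAt_id v).const_mul 2).sub ((hasDerivAt_pow 2 v).mul_const
      (a + 1 / 2))).add ((hasDerivAt_pow 3 v).mul_const (a / 3 + a ^ 2 / 3))).sub
      ((hasDerivAt_pow 4 v).mul_const (a ^ 2 / 8))
    refine this.congr_deriv ?_
    push_cast
    ring
  rw [intervalIntegral.integral_eq_sub_of_hasDerivAt hd
    (Continuous.intervalIntegrable (by fun_prop) _ _)]
  ring

theorem integral_one_sub_pow (n : ℕ) :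
    ∫ v in (0 : ℝ)..1, (1 - v) ^ n = 1 / ((n : ℝ) + 1) := by
  rw [intervalIntegral.integral_comp_sub_left (fun s => s ^ n) (1 : ℝ), integral_pow]
  simp

theorem integral_two_sub_mul_one_sub_pow (n : ℕ) :
    ∫ v in (0 : ℝ)..1, (2 - v) * (1 - v) ^ n = 1 / ((n : ℝ) + 1) + 1 / ((n : ℝ) + 2) := by
  have h : ∀ v : ℝ, (2 - v) * (1 - v) ^ n = (1 - v) ^ n + (1 - v) ^ (n + 1) := fun v => by ring
  simp only [h]
  rw [intervalIntegral.integral_add (Continuous.intervalIntegrable (by fun_prop) _ _)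
    (Continuous.intervalIntegrable (by fun_prop) _ _), integral_one_sub_pow, integral_one_sub_pow]
  push_cast
  congr 2
  ring

end CountGeneratingFunction

/-! ### Expectations of functions bounded through the number of points -/

section CountExpectations

variable {X : Type*} [MeasurableSpace X] {lam : Measure X} {Ω : Type*} [MeasurableSpace Ω]
  {ξ : Multiset X} {P : Measure Ω} {Z : ℝ≥0 → Ω → Multiset X}

theorem IsImmigrationDeathProcess.integral_one_sub_pow_card
    (hZ : IsImmigrationDeathProcess lam ξ P Z) {v : ℝ} (hv : v ∈ Set.Icc (0 : ℝ) 1) (t : ℝ≥0) :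
    ∫ ω, (1 - v) ^ Multiset.card (Z t ω) ∂P
      = countPGF (Multiset.card ξ) (lam.real Set.univ) (Real.exp (-(t : ℝ))) v := by
  have h := hZ.integral_prodFunctional (u := fun _ => 1 - v) measurable_const
    (fun _ => sub_nonneg.2 hv.2) (fun _ => by linarith [hv.1]) t
  simp only [prodFunctional_const] at h
  rw [h, immigrationFactor, countPGF]
  have h1 : thinFunction (Real.exp (-(t : ℝ))) (fun _ : X => 1 - v)
      = fun _ => 1 - Real.exp (-(t : ℝ)) * v := by
    funext x; simp [thinFunction]
  rw [h1, prodFunctional_const]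
  simp

/-- Fubini exchanges the expectation with the integral over `v`, which turns reciprocals of the
number of points into integrals of its generating function. -/
theorem IsImmigrationDeathProcess.integral_weighted_pow
    (hZ : IsImmigrationDeathProcess lam ξ P Z) {w : ℝ → ℝ} (hw : Continuous w) (t : ℝ≥0) :
    Integrable (fun ω => ∫ v in (0 : ℝ)..1, w v * (1 - v) ^ Multiset.card (Z t ω)) P ∧
    ∫ ω, (∫ v in (0 : ℝ)..1, w v * (1 - v) ^ Multiset.card (Z t ω)) ∂P
      = ∫ v in (0 : ℝ)..1, w v *
        countPGF (Multiset.card ξ) (lam.real Set.univ) (Real.exp (-(t : ℝ))) v := by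
  have := hZ.isProbabilityMeasure
  obtain ⟨C, hC⟩ := (isCompact_Icc (a := (0 : ℝ)) (b := 1)).exists_bound_of_continuousOn
    hw.continuousOn
  have hfin : IsFiniteMeasure (volume.restrict (Set.Ioc (0 : ℝ) 1)) := ⟨by simp⟩
  have hmeas : Measurable fun q : Ω × ℝ => w q.2 * (1 - q.2) ^ Multiset.card (Z t q.1) :=
    (hw.measurable.comp measurable_snd).mul ((measurable_const.sub measurable_snd).pow
      (measurable_card.comp ((hZ.measurable t).comp measurable_fst)))
  have hprod : Integrable (fun q : Ω × ℝ => w q.2 * (1 - q.2) ^ Multiset.card (Z t q.1))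
      (P.prod (volume.restrict (Set.Ioc (0 : ℝ) 1))) := by
    refine Integrable.of_bound hmeas.aestronglyMeasurable C ?_
    have hq : ∀ᵐ v ∂(volume.restrict (Set.Ioc (0 : ℝ) 1)), v ∈ Set.Ioc (0 : ℝ) 1 :=
      ae_restrict_mem measurableSet_Ioc
    have hq' := (Measure.quasiMeasurePreserving_snd (μ := P)
      (ν := volume.restrict (Set.Ioc (0 : ℝ) 1))).ae hq
    filter_upwards [hq'] with q hq
    rw [norm_mul]
    have h1 : ‖(1 - q.2) ^ Multiset.card (Z t q.1)‖ ≤ 1 := by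
      rw [norm_pow, Real.norm_eq_abs, abs_of_nonneg (sub_nonneg.2 hq.2)]
      exact pow_le_one₀ (sub_nonneg.2 hq.2) (by linarith [hq.1])
    exact (mul_le_of_le_one_right (norm_nonneg _) h1).trans (hC _ ⟨hq.1.le, hq.2⟩)
  simp only [intervalIntegral.integral_of_le zero_le_one]
  refine ⟨hprod.integral_prod_left, ?_⟩
  rw [integral_integral_swap (f := fun ω v => w v * (1 - v) ^ Multiset.card (Z t ω)) hprod]
  refine setIntegral_congr_fun measurableSet_Ioc fun v hv => ?_
  rw [integral_const_mul, hZ.integral_one_sub_pow_card ⟨hv.1.le, hv.2⟩]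

theorem IsImmigrationDeathProcess.abs_integral_le_of_le_weighted
    (hZ : IsImmigrationDeathProcess lam ξ P Z) {w : ℝ → ℝ} (hw : Continuous w)
    {k : Multiset X → ℝ}
    (hk : ∀ η, |k η| ≤ ∫ v in (0 : ℝ)..1, w v * (1 - v) ^ Multiset.card η) (t : ℝ≥0) :
    |∫ ω, k (Z t ω) ∂P| ≤ ∫ v in (0 : ℝ)..1, w v *
        countPGF (Multiset.card ξ) (lam.real Set.univ) (Real.exp (-(t : ℝ))) v := by
  obtain ⟨hi, he⟩ := hZ.integral_weighted_pow hw t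
  rw [← he, ← Real.norm_eq_abs]
  exact norm_integral_le_of_norm_le hi (Eventually.of_forall fun ω => hk _)

end CountExpectations

/-! ### Substitutions in the time integral -/

section TimeIntegral

/-- The substitution `p = e^{-t}` in an upper bound. -/
theorem abs_integral_exp_mul_le {D V : ℝ → ℝ} (hV : IntervalIntegrable V volume 0 1)
    (hD : ∀ t, 0 < t → |D t| ≤ V (Real.exp (-t))) :
    |∫ t in Set.Ioi (0 : ℝ), Real.exp (-t) * D t| ≤ ∫ p in (0 : ℝ)..1, V p := by
  have himg : (fun t : ℝ => Real.exp (-t)) '' Set.Ioi 0 = Set.Ioo 0 1 := by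
    ext p
    constructor
    · rintro ⟨t, ht, rfl⟩
      exact ⟨Real.exp_pos _, by simpa using ht⟩
    · rintro ⟨h0, h1⟩
      exact ⟨-Real.log p, by simpa using Real.log_neg h0 h1, by simp [Real.exp_log h0]⟩
  have hder : ∀ t ∈ Set.Ioi (0 : ℝ), HasDerivWithinAt (fun t : ℝ => Real.exp (-t))
      (-Real.exp (-t)) (Set.Ioi 0) t := fun t _ =>
    ((hasDerivAt_neg t).exp.congr_deriv (by ring)).hasDerivWithinAt
  have hinj : Set.InjOn (fun t : ℝ => Real.exp (-t)) (Set.Ioi 0) := fun a _ b _ h =>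
    neg_injective (Real.exp_injective h)
  have hV' : IntegrableOn V (Set.Ioo 0 1) :=
    ((intervalIntegrable_iff_integrableOn_Ioo_of_le zero_le_one).1 hV)
  have h1 := (integrableOn_image_iff_integrableOn_abs_deriv_smul measurableSet_Ioi hder hinj V)
  have h2 := integral_image_eq_integral_abs_deriv_smul measurableSet_Ioi hder hinj V
  rw [himg] at h1 h2
  simp only [abs_neg, Real.abs_exp, smul_eq_mul] at h1 h2
  rw [intervalIntegral.integral_of_le zero_le_one, integral_Ioc_eq_integral_Ioo, h2,
    ← Real.norm_eq_abs]
  refine norm_integral_le_of_norm_le (h1.1 hV') ?_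
  filter_upwards [ae_restrict_mem measurableSet_Ioi] with t ht
  rw [Real.norm_eq_abs, abs_mul, Real.abs_exp]
  exact mul_le_mul_of_nonneg_left (hD t ht) (Real.exp_pos _).le

/-- The substitution `a = l (1 - p)`. -/
theorem integral_comp_mul_one_sub {l : ℝ} (hl : l ≠ 0) (F : ℝ → ℝ) :
    ∫ p in (0 : ℝ)..1, F (l * (1 - p)) = l⁻¹ * ∫ a in (0 : ℝ)..l, F a := by
  rw [intervalIntegral.integral_comp_sub_left (fun q => F (l * q)) (1 : ℝ), sub_self, sub_zero,
    intervalIntegral.integral_comp_mul_left F hl, mul_zero, mul_one, smul_eq_mul]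

theorem intervalIntegrable_comp_mul_one_sub {l : ℝ} (hl : l ≠ 0) {F : ℝ → ℝ}
    (hF : IntervalIntegrable F volume 0 l) :
    IntervalIntegrable (fun p => F (l * (1 - p))) volume 0 1 := by
  have h1 := (hF.comp_mul_left (c := l)).comp_sub_left 1
  simpa [div_self hl] using h1.symm

end TimeIntegral

end PointPattern

namespace PointPattern

/-! ### Integrals of the envelopes behind the logarithmic bounds -/

section Calculus

theorem integral_ite_le_one {f g : ℝ → ℝ} {l : ℝ} (hl : 1 ≤ l)
    (hf : IntervalIntegrable f volume 0 1) (hg : IntervalIntegrable g volume 1 l) :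
    IntervalIntegrable (fun a => if a ≤ 1 then f a else g a) volume 0 l ∧
    ∫ a in (0 : ℝ)..l, (if a ≤ 1 then f a else g a)
      = (∫ a in (0 : ℝ)..1, f a) + ∫ a in (1 : ℝ)..l, g a := by
  have hfe : Set.EqOn f (fun a => if a ≤ 1 then f a else g a) (Set.uIoc 0 1) := fun a ha => by
    rw [Set.uIoc_of_le zero_le_one] at ha
    simp [ha.2]
  have hge : Set.EqOn g (fun a => if a ≤ 1 then f a else g a) (Set.uIoc 1 l) := fun a ha => by
    rw [Set.uIoc_of_le hl] at ha
    simp [not_le.2 ha.1]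
  have hf' := hf.congr hfe
  have hg' := hg.congr hge
  refine ⟨hf'.trans hg', ?_⟩
  rw [← intervalIntegral.integral_add_adjacent_intervals hf' hg',
    intervalIntegral.integral_congr_ae (Eventually.of_forall fun _ ha => hfe ha),
    intervalIntegral.integral_congr_ae (Eventually.of_forall fun _ ha => hge ha)]

theorem integral_quadratic_envelope (l : ℝ) :
    ∫ a in (0 : ℝ)..l, (1 - a / 2 + a ^ 2 / 6) = l - l ^ 2 / 4 + l ^ 3 / 18 := by
  have hd : ∀ a ∈ Set.uIcc (0 : ℝ) l,
      HasDerivAt (fun a : ℝ => a - a ^ 2 / 4 + a ^ 3 / 18) (1 - a / 2 + a ^ 2 / 6) a :=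
    fun a _ => by
    have := ((hasDerivAt_id a).sub ((hasDerivAt_pow 2 a).div_const 4)).add
      ((hasDerivAt_pow 3 a).div_const 18)
    refine this.congr_deriv ?_
    push_cast
    ring
  rw [intervalIntegral.integral_eq_sub_of_hasDerivAt hd
    (Continuous.intervalIntegrable (by fun_prop) _ _)]
  ring

theorem integral_first_envelope {l : ℝ} (hl : 1 ≤ l) :
    IntervalIntegrable (fun a : ℝ => if a ≤ 1 then 1 - a / 2 + a ^ 2 / 6 else 1 / a) volume 0 l ∧
    ∫ a in (0 : ℝ)..l, (if a ≤ 1 then 1 - a / 2 + a ^ 2 / 6 else 1 / a) ≤ 0.95 + Real.log l := by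
  have hg : IntervalIntegrable (fun a : ℝ => 1 / a) volume 1 l := by
    refine ContinuousOn.intervalIntegrable fun a ha => ?_
    rw [Set.uIcc_of_le hl] at ha
    exact (continuousAt_const.div continuousAt_id
      (by simp only [id]; linarith [ha.1])).continuousWithinAt
  obtain ⟨h1, h2⟩ := integral_ite_le_one hl
    (f := fun a => 1 - a / 2 + a ^ 2 / 6) (Continuous.intervalIntegrable (by fun_prop) _ _) hg
  refine ⟨h1, ?_⟩
  -- The part over `[0,1]` equals `1 - 1/4 + 1/18 = 29/36`, which is below `0.95`.
  rw [h2, integral_quadratic_envelope, integral_one_div_of_pos one_pos (by linarith), div_one]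
  norm_num

theorem integral_second_envelope {l : ℝ} (hl : 1.76 ≤ l) :
    IntervalIntegrable (fun a : ℝ => if a ≤ 1 then
      (1 - a / l) * (3 / 2 - 2 * a / 3 + 5 * a ^ 2 / 24)
      else (1 - a / l) * (2 / a - 1 / a ^ 2)) volume 0 l ∧
    ∫ a in (0 : ℝ)..l, (if a ≤ 1 then (1 - a / l) * (3 / 2 - 2 * a / 3 + 5 * a ^ 2 / 24)
      else (1 - a / l) * (2 / a - 1 / a ^ 2)) ≤ 2 * Real.log l := by
  have hl1 : 1 ≤ l := by norm_num at hl; linarith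
  have hl0 : l ≠ 0 := by positivity
  have hg : IntervalIntegrable (fun a : ℝ => (1 - a / l) * (2 / a - 1 / a ^ 2)) volume 1 l := by
    refine ContinuousOn.intervalIntegrable fun a ha => ?_
    rw [Set.uIcc_of_le hl1] at ha
    have ha0 : a ≠ 0 := by linarith [ha.1]
    refine ContinuousAt.continuousWithinAt ?_
    fun_prop (disch := simp [ha0])
  obtain ⟨h1, h2⟩ := integral_ite_le_one hl1
    (f := fun a => (1 - a / l) * (3 / 2 - 2 * a / 3 + 5 * a ^ 2 / 24))
    (Continuous.intervalIntegrable (by fun_prop) _ _) hg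
  refine ⟨h1, ?_⟩
  have hd1 : ∀ a ∈ Set.uIcc (0 : ℝ) 1,
      HasDerivAt (fun a : ℝ => 3 / 2 * a - a ^ 2 / 3 + 5 * a ^ 3 / 72
        - (3 * a ^ 2 / 4 - 2 * a ^ 3 / 9 + 5 * a ^ 4 / 96) / l)
        ((1 - a / l) * (3 / 2 - 2 * a / 3 + 5 * a ^ 2 / 24)) a := fun a _ => by
    have := ((((hasDerivAt_id a).const_mul (3 / 2)).sub ((hasDerivAt_pow 2 a).div_const 3)).add
      (((hasDerivAt_pow 3 a).const_mul 5).div_const 72)).sub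
      ((((((hasDerivAt_pow 2 a).const_mul 3).div_const 4).sub
        (((hasDerivAt_pow 3 a).const_mul 2).div_const 9)).add
        (((hasDerivAt_pow 4 a).const_mul 5).div_const 96)).div_const l)
    refine this.congr_deriv ?_
    push_cast
    field_simp
    ring
  have hd2 : ∀ a ∈ Set.uIcc (1 : ℝ) l,
      HasDerivAt (fun a : ℝ => 2 * Real.log a + a⁻¹ - 2 * a / l + Real.log a / l)
        ((1 - a / l) * (2 / a - 1 / a ^ 2)) a := fun a ha => by
    rw [Set.uIcc_of_le hl1] at ha
    have ha0 : a ≠ 0 := by linarith [ha.1]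
    have := (((((Real.hasDerivAt_log ha0).const_mul 2).add (hasDerivAt_inv ha0)).sub
      (((hasDerivAt_id a).const_mul 2).div_const l))).add ((Real.hasDerivAt_log ha0).div_const l)
    refine this.congr_deriv ?_
    field_simp
    ring
  rw [h2, intervalIntegral.integral_eq_sub_of_hasDerivAt hd1
    (Continuous.intervalIntegrable (by fun_prop) _ _),
    intervalIntegral.integral_eq_sub_of_hasDerivAt hd2 hg]
  -- The tangent line of the logarithm at `2` is accurate enough near the threshold `1.76`.
  have hlog : Real.log l ≤ l / 2 - 1 + Real.log 2 := by
    have := Real.log_le_sub_one_of_pos (x := l / 2) (by positivity)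
    rw [Real.log_div hl0 two_ne_zero] at this
    linarith
  have hlog2 := Real.log_two_lt_d9
  -- The integral over `[0,1]` is `89/72 - (167/288)/l`, and that over `[1,l]` is `2 log l - 3 + (3
  -- + log l)/l`. This inequality says that everything besides `2 log l` sums to at most zero;
  -- through the tangent bound it becomes linear in `l`.
  have key : (3 - 167 / 288 + Real.log l) / l ≤ 3 - 89 / 72 := by
    rw [div_le_iff₀ (by positivity)]
    norm_num at hl hlog2 ⊢
    linarith
  have e1 : 2 * l / l = 2 := by field_simp
  simp only [Real.log_one, e1]
  have e2 : (3 - 167 / 288 + Real.log l) / l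
      = 2 * 1 / l + l⁻¹ + Real.log l / l - 167 / 288 / l := by
    field_simp; ring
  have e3 : (3 * (1 : ℝ) ^ 2 / 4 - 2 * 1 ^ 3 / 9 + 5 * 1 ^ 4 / 96) / l = 167 / 288 / l := by
    norm_num
  rw [e2] at key
  rw [e3]
  norm_num at key ⊢
  linarith

end Calculus

/-! ### Bounds on the inner integral over `v` -/

section CountBounds

variable {n : ℕ} {l p : ℝ}

theorem integral_countPGF_le_of_le {g : ℝ → ℝ} (hg : Continuous g)
    (h : ∀ v ∈ Set.Icc (0 : ℝ) 1, countPGF n l p v ≤ g v) :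
    ∫ v in (0 : ℝ)..1, 1 * countPGF n l p v ≤ ∫ v in (0 : ℝ)..1, g v := by
  simp only [one_mul]
  exact intervalIntegral.integral_mono_on zero_le_one
    ((continuous_countPGF n l p).intervalIntegrable _ _) (hg.intervalIntegrable _ _) h

theorem integral_two_sub_mul_countPGF_le_of_le {g : ℝ → ℝ} (hg : Continuous g)
    (h : ∀ v ∈ Set.Icc (0 : ℝ) 1, (2 - v) * countPGF n l p v ≤ g v) :
    ∫ v in (0 : ℝ)..1, (2 - v) * countPGF n l p v ≤ ∫ v in (0 : ℝ)..1, g v :=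
  intervalIntegral.integral_mono_on zero_le_one
    (((continuous_const.sub continuous_id).mul (continuous_countPGF n l p)).intervalIntegrable _ _)
    (hg.intervalIntegrable _ _) h

theorem integral_countPGF_le_one (hl : 0 ≤ l) (hp : p ∈ Set.Icc (0 : ℝ) 1) :
    ∫ v in (0 : ℝ)..1, 1 * countPGF n l p v ≤ 1 :=
  (integral_countPGF_le_of_le continuous_const fun _ hv => countPGF_le_one hl hp hv).trans
    (by simp)

theorem integral_countPGF_le_expQuotient (hp : p ∈ Set.Icc (0 : ℝ) 1) :
    ∫ v in (0 : ℝ)..1, 1 * countPGF n l p v ≤ expQuotient (min (n : ℝ) l) :=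
  (integral_countPGF_le_of_le (by fun_prop) fun _ hv => countPGF_le_exp_min hp hv).trans
    (integral_exp_neg_mul_eq_expQuotient _).le

theorem integral_countPGF_le_quadratic (hl : 0 ≤ l) (hp : p ∈ Set.Icc (0 : ℝ) 1) :
    ∫ v in (0 : ℝ)..1, 1 * countPGF n l p v
      ≤ 1 - (l * (1 - p)) / 2 + (l * (1 - p)) ^ 2 / 6 :=
  (integral_countPGF_le_of_le (by fun_prop) fun _ hv => countPGF_le_exp_immigration hp hv).trans
    (integral_exp_neg_mul_le_quadratic (mul_nonneg hl (sub_nonneg.2 hp.2)))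

theorem integral_countPGF_le_inv (hp : p ∈ Set.Icc (0 : ℝ) 1) (ha : 0 < l * (1 - p)) :
    ∫ v in (0 : ℝ)..1, 1 * countPGF n l p v ≤ 1 / (l * (1 - p)) :=
  (integral_countPGF_le_of_le (by fun_prop) fun _ hv => countPGF_le_exp_immigration hp hv).trans
    (integral_exp_neg_mul_le ha)

theorem integral_two_sub_mul_countPGF_le (hl : 0 ≤ l) (hp : p ∈ Set.Icc (0 : ℝ) 1) :
    ∫ v in (0 : ℝ)..1, (2 - v) * countPGF n l p v ≤ 3 / 2 := by
  refine (integral_two_sub_mul_countPGF_le_of_le (g := fun v => (2 - v) * Real.exp (-(v * 0)))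
    (by fun_prop) fun v hv => ?_).trans
    ((integral_two_sub_mul_exp_le_quadratic le_rfl).trans (by norm_num))
  have := countPGF_le_one (n := n) hl hp hv
  simp only [mul_zero, neg_zero, Real.exp_zero]
  exact mul_le_mul_of_nonneg_left this (by linarith [hv.2])

theorem integral_two_sub_mul_countPGF_le_min (hp : p ∈ Set.Icc (0 : ℝ) 1)
    (hm : 0 < min (n : ℝ) l) :
    ∫ v in (0 : ℝ)..1, (2 - v) * countPGF n l p v ≤ 2 * (1 / min (n : ℝ) l) := by
  refine (integral_two_sub_mul_countPGF_le_of_le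
    (g := fun v => 2 * Real.exp (-(v * min (n : ℝ) l))) (by fun_prop) fun v hv => ?_).trans ?_
  · exact mul_le_mul (by linarith [hv.1]) (countPGF_le_exp_min hp hv)
      (mul_nonneg (Real.exp_pos _).le
        (pow_nonneg (by nlinarith [hp.1, hp.2, hv.1, hv.2]) n)) zero_le_two
  · rw [intervalIntegral.integral_const_mul]
    exact mul_le_mul_of_nonneg_left (integral_exp_neg_mul_le hm) zero_le_two

/-- Convexity of the reciprocal; after clearing denominators the difference of the two sides is `p
(1-p) (x-y)²`. -/
theorem one_div_convex_comb_le {x y : ℝ} (hx : 0 < x) (hy : 0 < y) (hp : p ∈ Set.Icc (0 : ℝ) 1) :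
    1 / (x * p + y * (1 - p)) ≤ p / x + (1 - p) / y := by
  have hq := sub_nonneg.2 hp.2
  have hpos : 0 < x * p + y * (1 - p) := by
    rcases hp.1.eq_or_lt with h | h
    · rw [← h]; simpa using hy
    · have := mul_pos hx h; have := mul_nonneg hy.le hq; linarith
  rw [div_le_iff₀ hpos, div_add_div _ _ hx.ne' hy.ne', div_mul_eq_mul_div,
    le_div_iff₀ (mul_pos hx hy)]
  nlinarith [mul_nonneg (mul_nonneg hp.1 hq) (sq_nonneg (x - y))]

theorem integral_two_sub_mul_countPGF_le_convex (hl : 0 < l) (hp : p ∈ Set.Icc (0 : ℝ) 1) :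
    ∫ v in (0 : ℝ)..1, (2 - v) * countPGF n l p v
      ≤ Real.exp 1 * (p / (n + 1) + (1 - p) / l) := by
  have hn : (0 : ℝ) < n + 1 := by positivity
  have hpos : 0 < ((n : ℝ) + 1) * p + l * (1 - p) := by
    rcases hp.1.eq_or_lt with h | h
    · rw [← h]; simpa using hl
    · have := mul_pos hn h; have := mul_nonneg hl.le (sub_nonneg.2 hp.2); linarith
  refine (integral_two_sub_mul_countPGF_le_of_le (by fun_prop)
    fun v hv => countPGF_mul_le_exp_succ hp hv).trans ?_
  rw [intervalIntegral.integral_const_mul]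
  exact mul_le_mul_of_nonneg_left ((integral_exp_neg_mul_le hpos).trans
    (one_div_convex_comb_le hn hl hp)) (Real.exp_pos _).le

theorem integral_two_sub_mul_countPGF_le_exp (hp : p ∈ Set.Icc (0 : ℝ) 1) :
    ∫ v in (0 : ℝ)..1, (2 - v) * countPGF n l p v
      ≤ ∫ v in (0 : ℝ)..1, (2 - v) * Real.exp (-(v * (l * (1 - p)))) :=
  integral_two_sub_mul_countPGF_le_of_le (by fun_prop) fun _ hv =>
    mul_le_mul_of_nonneg_left (countPGF_le_exp_immigration hp hv) (by linarith [hv.2])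

end CountBounds

/-! ### The Stein factors -/

section SteinFactors

variable {X : Type*} [MetricSpace X] [CompactSpace X] [MeasurableSpace X] [BorelSpace X]
  {lam : Measure X} [IsFiniteMeasure lam] {Ω : Type*} [MeasurableSpace Ω]
  {P : Multiset X → Measure Ω} {Z : Multiset X → ℝ≥0 → Ω → Multiset X} {f : Multiset X → ℝ}

theorem abs_firstDiff_steinSolution_le (hd : ∀ x y : X, dist x y ≤ 1)
    (hZ : ∀ ξ, IsImmigrationDeathProcess lam ξ (P ξ) (Z ξ)) (hf : IsDbar1Lipschitz f)
    (ξ : Multiset X) (α : X) {V : ℝ → ℝ} (hV : IntervalIntegrable V volume 0 1)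
    (hb : ∀ p ∈ Set.Ioo (0 : ℝ) 1, ∫ v in (0 : ℝ)..1,
      1 * countPGF (Multiset.card ξ) (lam.real Set.univ) p v ≤ V p) :
    |firstDiff (steinSolution lam P Z f) ξ α| ≤ ∫ p in (0 : ℝ)..1, V p := by
  rw [firstDiff_steinSolution hZ hf.measurable (hf.abs_sub_zero_le hd), abs_neg]
  refine abs_integral_exp_mul_le hV fun t ht => ?_
  have h := (hZ ξ).abs_integral_le_of_le_weighted (w := fun _ => 1) continuous_const
    (k := fun η => firstDiff f η α) (fun η => by
      simp only [one_mul, integral_one_sub_pow]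
      exact hf.abs_firstDiff_le η α) t.toNNReal
  rw [Real.coe_toNNReal t ht.le] at h
  exact h.trans (hb _ ⟨Real.exp_pos _, by simpa using ht⟩)

/-- Of the factor `e^{-2t}`, one `e^{-t}` is absorbed by `dp` in the substitution `p = e^{-t}`; the
other remains as the weight `p`. -/
theorem abs_secondDiff_steinSolution_le (hd : ∀ x y : X, dist x y ≤ 1)
    (hZ : ∀ ξ, IsImmigrationDeathProcess lam ξ (P ξ) (Z ξ)) (hf : IsDbar1Lipschitz f)
    (ξ : Multiset X) (α β : X) {V : ℝ → ℝ} (hV : IntervalIntegrable V volume 0 1)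
    (hb : ∀ p ∈ Set.Ioo (0 : ℝ) 1, p * ∫ v in (0 : ℝ)..1,
      (2 - v) * countPGF (Multiset.card ξ) (lam.real Set.univ) p v ≤ V p) :
    |secondDiff (steinSolution lam P Z f) ξ α β| ≤ ∫ p in (0 : ℝ)..1, V p := by
  rw [secondDiff_steinSolution hZ hf.measurable (hf.abs_sub_zero_le hd), abs_neg]
  refine abs_integral_exp_mul_le hV fun t ht => ?_
  have h := (hZ ξ).abs_integral_le_of_le_weighted (w := fun v => 2 - v) (by fun_prop)
    (k := fun η => secondDiff f η α β) (fun η => by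
      rw [integral_two_sub_mul_one_sub_pow]
      exact hf.abs_secondDiff_le η α β) t.toNNReal
  rw [Real.coe_toNNReal t ht.le] at h
  rw [abs_mul, Real.abs_exp]
  exact (mul_le_mul_of_nonneg_left h (Real.exp_pos _).le).trans
    (hb _ ⟨Real.exp_pos _, by simpa using ht⟩)

theorem abs_firstDiff_steinSolution_le_log (hd : ∀ x y : X, dist x y ≤ 1)
    (hZ : ∀ ξ, IsImmigrationDeathProcess lam ξ (P ξ) (Z ξ)) (hf : IsDbar1Lipschitz f)
    (ξ : Multiset X) (α : X) (hl : 0 < lam.real Set.univ) :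
    |firstDiff (steinSolution lam P Z f) ξ α|
      ≤ (0.95 + Real.posLog (lam.real Set.univ)) / lam.real Set.univ := by
  set l := lam.real Set.univ with hldef
  rcases le_total l 1 with h1 | h1
  · refine (abs_firstDiff_steinSolution_le hd hZ hf ξ α
      (V := fun p => 1 - (l * (1 - p)) / 2 + (l * (1 - p)) ^ 2 / 6)
      (Continuous.intervalIntegrable (by fun_prop) _ _)
      fun p hp => integral_countPGF_le_quadratic hl.le ⟨hp.1.le, hp.2.le⟩).trans ?_
    rw [integral_comp_mul_one_sub hl.ne' (fun a => 1 - a / 2 + a ^ 2 / 6),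
      integral_quadratic_envelope, inv_mul_eq_div]
    refine div_le_div_of_nonneg_right ?_ hl.le
    have := Real.posLog_nonneg (x := l)
    norm_num
    nlinarith [mul_nonneg hl.le (sub_nonneg.2 h1),
      mul_nonneg (mul_nonneg hl.le hl.le) (sub_nonneg.2 h1)]
  · obtain ⟨hi, hle⟩ := integral_first_envelope h1
    refine (abs_firstDiff_steinSolution_le hd hZ hf ξ α
      (intervalIntegrable_comp_mul_one_sub hl.ne' hi) fun p hp => ?_).trans ?_
    · have hp' : p ∈ Set.Icc (0 : ℝ) 1 := ⟨hp.1.le, hp.2.le⟩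
      split_ifs with ha
      · exact integral_countPGF_le_quadratic hl.le hp'
      · exact integral_countPGF_le_inv hp' (mul_pos hl (sub_pos.2 hp.2))
    · rw [integral_comp_mul_one_sub hl.ne'
        (fun a => if a ≤ 1 then 1 - a / 2 + a ^ 2 / 6 else 1 / a), inv_mul_eq_div,
        Real.posLog_eq_log (by rwa [abs_of_pos hl])]
      gcongr

theorem abs_secondDiff_steinSolution_le_log (hd : ∀ x y : X, dist x y ≤ 1)
    (hZ : ∀ ξ, IsImmigrationDeathProcess lam ξ (P ξ) (Z ξ)) (hf : IsDbar1Lipschitz f)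
    (ξ : Multiset X) (α β : X) (hl : 1.76 ≤ lam.real Set.univ) :
    |secondDiff (steinSolution lam P Z f) ξ α β|
      ≤ 2 * Real.log (lam.real Set.univ) / lam.real Set.univ := by
  set l := lam.real Set.univ with hldef
  have hl0 : 0 < l := lt_of_lt_of_le (by norm_num) hl
  obtain ⟨hi, hle⟩ := integral_second_envelope hl
  refine (abs_secondDiff_steinSolution_le hd hZ hf ξ α β
    (intervalIntegrable_comp_mul_one_sub hl0.ne' hi) fun p hp => ?_).trans ?_
  · have hp' : p ∈ Set.Icc (0 : ℝ) 1 := ⟨hp.1.le, hp.2.le⟩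
    -- In the variable `a = l(1-p)` the weight `p` is the factor `1 - a/l` of the envelope.
    have he : 1 - l * (1 - p) / l = p := by field_simp; ring
    simp only [he]
    split_ifs with ha
    · exact mul_le_mul_of_nonneg_left ((integral_two_sub_mul_countPGF_le_exp hp').trans
        (integral_two_sub_mul_exp_le_quadratic (mul_nonneg hl0.le (sub_nonneg.2 hp'.2)))) hp'.1
    · exact mul_le_mul_of_nonneg_left ((integral_two_sub_mul_countPGF_le_exp hp').trans
        (integral_two_sub_mul_exp_le (not_le.1 ha).le)) hp'.1
  · rw [integral_comp_mul_one_sub hl0.ne' (fun a => if a ≤ 1 then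
      (1 - a / l) * (3 / 2 - 2 * a / 3 + 5 * a ^ 2 / 24)
      else (1 - a / l) * (2 / a - 1 / a ^ 2)), inv_mul_eq_div]
    gcongr

theorem abs_secondDiff_steinSolution_le_const (hd : ∀ x y : X, dist x y ≤ 1)
    (hZ : ∀ ξ, IsImmigrationDeathProcess lam ξ (P ξ) (Z ξ)) (hf : IsDbar1Lipschitz f)
    (ξ : Multiset X) (α β : X) : |secondDiff (steinSolution lam P Z f) ξ α β| ≤ 0.75 := by
  refine (abs_secondDiff_steinSolution_le hd hZ hf ξ α β (V := fun p => p * (3 / 2))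
    (Continuous.intervalIntegrable (by fun_prop) _ _) fun p hp => mul_le_mul_of_nonneg_left
      (integral_two_sub_mul_countPGF_le measureReal_nonneg ⟨hp.1.le, hp.2.le⟩) hp.1.le).trans ?_
  rw [intervalIntegral.integral_mul_const, integral_id]
  norm_num

theorem abs_secondDiff_steinSolution_le_min (hd : ∀ x y : X, dist x y ≤ 1)
    (hZ : ∀ ξ, IsImmigrationDeathProcess lam ξ (P ξ) (Z ξ)) (hf : IsDbar1Lipschitz f)
    (ξ : Multiset X) (α β : X) (hm : 0 < min (Multiset.card ξ : ℝ) (lam.real Set.univ)) :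
    |secondDiff (steinSolution lam P Z f) ξ α β|
      ≤ 1 / min (Multiset.card ξ : ℝ) (lam.real Set.univ) := by
  refine (abs_secondDiff_steinSolution_le hd hZ hf ξ α β
    (V := fun p => p * (2 * (1 / min (Multiset.card ξ : ℝ) (lam.real Set.univ))))
    (Continuous.intervalIntegrable (by fun_prop) _ _) fun p hp => mul_le_mul_of_nonneg_left
      (integral_two_sub_mul_countPGF_le_min ⟨hp.1.le, hp.2.le⟩ hm) hp.1.le).trans (le_of_eq ?_)
  rw [intervalIntegral.integral_mul_const, integral_id]
  ring

theorem abs_secondDiff_steinSolution_le_add (hd : ∀ x y : X, dist x y ≤ 1)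
    (hZ : ∀ ξ, IsImmigrationDeathProcess lam ξ (P ξ) (Z ξ)) (hf : IsDbar1Lipschitz f)
    (ξ : Multiset X) (α β : X) (hl : 0 < lam.real Set.univ) :
    |secondDiff (steinSolution lam P Z f) ξ α β|
      ≤ 1.09 / ((Multiset.card ξ : ℝ) + 1) + 1 / lam.real Set.univ := by
  set l := lam.real Set.univ with hldef
  set m : ℝ := (Multiset.card ξ : ℝ) + 1 with hm
  have hm0 : 0 < m := by positivity
  refine (abs_secondDiff_steinSolution_le hd hZ hf ξ α β
    (V := fun p => p * (Real.exp 1 * (p / m + (1 - p) / l)))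
    (Continuous.intervalIntegrable (by fun_prop) _ _) fun p hp => mul_le_mul_of_nonneg_left
      (integral_two_sub_mul_countPGF_le_convex hl ⟨hp.1.le, hp.2.le⟩) hp.1.le).trans ?_
  have hder : ∀ p ∈ Set.uIcc (0 : ℝ) 1,
      HasDerivAt (fun p : ℝ => Real.exp 1 * (p ^ 3 / 3 / m + (p ^ 2 / 2 - p ^ 3 / 3) / l))
        (p * (Real.exp 1 * (p / m + (1 - p) / l))) p := fun p _ => by
    have := (((((hasDerivAt_pow 3 p).div_const 3).div_const m)).add
      ((((hasDerivAt_pow 2 p).div_const 2).sub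
        ((hasDerivAt_pow 3 p).div_const 3)).div_const l)).const_mul (Real.exp 1)
    refine this.congr_deriv ?_
    push_cast
    ring
  rw [intervalIntegral.integral_eq_sub_of_hasDerivAt hder
    (Continuous.intervalIntegrable (by fun_prop) _ _)]
  have he := Real.exp_one_lt_d9
  -- Since `∫ p² = 1/3` and `∫ p(1-p) = 1/6`, the constants are `e/3 < 1.09` and `e/6 < 1`.
  have h1 : Real.exp 1 / 3 / m ≤ 1.09 / m := by
    gcongr; norm_num at he ⊢; linarith
  have h2 : Real.exp 1 / 6 / l ≤ 1 / l := by
    gcongr; norm_num at he ⊢; linarith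
  have h3 : Real.exp 1 * ((1 : ℝ) ^ 3 / 3 / m + (1 ^ 2 / 2 - 1 ^ 3 / 3) / l)
      - Real.exp 1 * ((0 : ℝ) ^ 3 / 3 / m + (0 ^ 2 / 2 - 0 ^ 3 / 3) / l)
      = Real.exp 1 / 3 / m + Real.exp 1 / 6 / l := by ring
  rw [h3]
  linarith

end SteinFactors

end PointPattern

theorem proposition4 {X : Type*} [MetricSpace X] [CompactSpace X] [MeasurableSpace X]
    [BorelSpace X] (hd : ∀ x y : X, dist x y ≤ 1)
    (lam : Measure X) [IsFiniteMeasure lam]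
    {Ω : Type*} [MeasurableSpace Ω] (P : Multiset X → Measure Ω)
    (Z : Multiset X → ℝ≥0 → Ω → Multiset X)
    (hZ : ∀ ξ, IsImmigrationDeathProcess lam ξ (P ξ) (Z ξ))
    (f : Multiset X → ℝ) (hf : IsDbar1Lipschitz f) :
    -- all the integrals in the definition of `h_f` exist
    (Integrable f (poissonProcess lam) ∧
      (∀ ξ t, Integrable (fun ω => f (Z ξ t ω)) (P ξ)) ∧
      ∀ ξ, IntegrableOn (fun t : ℝ => expectationGap lam P Z f ξ t.toNNReal) (Set.Ioi 0)) ∧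
    -- first differences; a bound with denominator zero is read as `∞`
    (∀ (ξ : Multiset X) (α : X),
      |firstDiff (steinSolution lam P Z f) ξ α| ≤ 1 ∧
      (0 < lam.real Set.univ →
        |firstDiff (steinSolution lam P Z f) ξ α|
          ≤ (0.95 + Real.posLog (lam.real Set.univ)) / lam.real Set.univ) ∧
      |firstDiff (steinSolution lam P Z f) ξ α|
        ≤ expQuotient (min (Multiset.card ξ : ℝ) (lam.real Set.univ))) ∧
    -- second differences
    (∀ (ξ : Multiset X) (α β : X),
      |secondDiff (steinSolution lam P Z f) ξ α β| ≤ 0.75 ∧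
      (0 < min (Multiset.card ξ : ℝ) (lam.real Set.univ) →
        |secondDiff (steinSolution lam P Z f) ξ α β|
          ≤ 1 / min (Multiset.card ξ : ℝ) (lam.real Set.univ)) ∧
      (0 < lam.real Set.univ →
        |secondDiff (steinSolution lam P Z f) ξ α β|
          ≤ 1.09 / ((Multiset.card ξ : ℝ) + 1) + 1 / lam.real Set.univ) ∧
      |secondDiff (steinSolution lam P Z f) ξ α β|
        ≤ if 1.76 ≤ lam.real Set.univ then
            2 * Real.log (lam.real Set.univ) / lam.real Set.univ
          else 0.75) := by
  have hm := hf.measurable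
  have hb := hf.abs_sub_zero_le hd
  have hfb : ∀ η, |f η| ≤ |f 0| + 1 := fun η => by
    have := abs_add_le (f η - f 0) (f 0)
    rw [sub_add_cancel] at this
    linarith [hb η]
  refine ⟨⟨Integrable.of_bound hm.aestronglyMeasurable _ (Eventually.of_forall hfb),
    fun ξ t => (hZ ξ).integrable_comp hm hfb t, integrableOn_expectationGap hZ hm hb⟩,
    fun ξ α => ⟨?_, abs_firstDiff_steinSolution_le_log hd hZ hf ξ α, ?_⟩,
    fun ξ α β => ⟨abs_secondDiff_steinSolution_le_const hd hZ hf ξ α β,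
      abs_secondDiff_steinSolution_le_min hd hZ hf ξ α β,
      abs_secondDiff_steinSolution_le_add hd hZ hf ξ α β, ?_⟩⟩
  · refine (abs_firstDiff_steinSolution_le hd hZ hf ξ α (V := fun _ => 1)
      intervalIntegrable_const fun p hp =>
        integral_countPGF_le_one measureReal_nonneg ⟨hp.1.le, hp.2.le⟩).trans (by simp)
  · refine (abs_firstDiff_steinSolution_le hd hZ hf ξ α
      (V := fun _ => expQuotient (min (Multiset.card ξ : ℝ) (lam.real Set.univ)))
      intervalIntegrable_const fun p hp =>
        integral_countPGF_le_expQuotient ⟨hp.1.le, hp.2.le⟩).trans (by simp)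
  · split_ifs with hl
    · exact abs_secondDiff_steinSolution_le_log hd hZ hf ξ α β hl
    · exact abs_secondDiff_steinSolution_le_const hd hZ hf ξ α β
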